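/- Let $G=(V,D,B)$ be a mixed graph: $V$ is a finite set, $D$ a set of directed edges $v\to w$ and $B$ a set of bidirected (unordered) edges $v\leftrightarrow w$, both without self-loops. Index matrices by $V\times V$. Let $\mathbb R^D_{\mathrm{reg}}$ be the set of real matrices $\Lambda$ with $\lambda_{vw}=0$ whenever $v\to w\notin D$ and with $I-\Lambda$ invertible, let $\mathrm{PD}(B)$ be the set of real symmetric positive definite matrices $\Omega$ with $\omega_{vw}=0$ whenever $v\neq w$ and $v\leftrightarrow w\notin B$, and put $\Theta=\mathbb R^D_{\mathrm{reg}}\times \mathrm{PD}(B)$ and $\phi_G(\Lambda,\Omega)=(I-\Lambda)^{-T}\Omega(I-\Lambda)^{-1}$. Let $\phi_{G,\mathbb C}$ be the map given by the same formula on the set $\Theta_{\mathbb C}$ of pairs $(\Lambda,\Omega)$ with $\Lambda\in\mathbb C^D_{\mathrm{reg}}$ (defined as above with complex entries) and $\Omega$ complex symmetric with $\omega_{vw}=0$ whenever $v\ne w$ and $v\leftrightarrow w\notin B$. A proper algebraic subset of $\Theta$ (or $\Theta_{\mathbb C}$) is a subset, different from the whole set, that is defined by polynomial equations in the entries of $(\Lambda,\Omega)$.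 The graph $G$ is *generically identifiable* if $\phi_G$ is injective on $\Theta\setminus W$ for some proper algebraic subset $W$; it is *rationally identifiable* if there are a proper algebraic subset $W$ and a rational map $\psi$ with $\psi(\phi_G(\Lambda,\Omega))=(\Lambda,\Omega)$ for all $(\Lambda,\Omega)\in\Theta\setminus W$. For $h\in\mathbb N\cup\{\infty\}$, the map $\phi_G$ (or $\phi_{G,\mathbb C}$) is *generically $h$-to-one* if, for some proper algebraic subset $W$ of its domain, the fiber through every point of the domain outside $W$ has exactly $h$ elements; $G$ is *generically infinite-to-one* if $\phi_G$ is generically $\infty$-to-one. The *degree of identifiability* $\mathrm{ID}(G)\in\mathbb N\cup\{\infty\}$ is the number $h$ for which $\phi_{G,\mathbb C}$ is generically $h$-to-one. Suppose that $G$ is acyclic, that is, $(V,D)$ has no directed cycle. Let $C_1,\dots,C_k\subset V$ be the vertex sets of the connected components of $(V,B)$, let $V_j$ be the union of $C_j$ and the set of all $p\in V$ with $p\to v\in D$ for some $v\in C_j$, let $D_j$ be the set of edges $v\to w$ in $D$ with $v\in V_j$ and $w\in C_j$, and let $B_j$ be the set of edges in $B$ between nodes of $C_j$. The graphs $G_j=(V_j,D_j,B_j)$,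 $j=1,\dots,k$, are the mixed components of $G$. Then: (i) $G$ is rationally identifiable if and only if all of $G_1,\dots,G_k$ are rationally identifiable, and $G$ is generically identifiable if and only if all of $G_1,\dots,G_k$ are generically identifiable. (ii) $G$ is generically infinite-to-one if and only if some $G_j$ is generically infinite-to-one; likewise, $\phi_{G,\mathbb C}$ is generically $\infty$-to-one if and only if some $\phi_{G_j,\mathbb C}$ is. (iii) If $h_1,\dots,h_k\in\mathbb N$ and each $\phi_{G_j}$ is generically $h_j$-to-one, then $\phi_G$ is generically $\left(\prod_{j=1}^k h_j\right)$-to-one; the same holds for $\phi_{G,\mathbb C}$ and the $\phi_{G_j,\mathbb C}$. Moreover, $\mathrm{ID}(G)=\prod_{j=1}^k\mathrm{ID}(G_j)$ in $\mathbb N\cup\{\infty\}$. -/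

import Mathlib

/-- A mixed graph `(V, D, B)`: directed edges `v → w` without self-loops, and symmetric
bidirected edges `v ↔ w` without self-loops (a simple graph). -/
structure MixedGraph (V : Type*) where
  directed : V → V → Prop
  directed_irrefl : ∀ v, ¬ directed v v
  bidirected : SimpleGraph V

/-- A pair `(Λ, Ω)` of square matrices. -/
abbrev ParamPair (V K : Type*) := Matrix V V K × Matrix V V K

/-- The entries of a pair `(Λ, Ω)`: `Sum.inl (v, w)` is `Λ v w`, `Sum.inr (v, w)` is `Ω v w`. -/
def ParamPair.coords {V K : Type*} (θ : ParamPair V K) : (V × V) ⊕ (V × V) → K :=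
  Sum.elim (fun e => θ.1 e.1 e.2) (fun e => θ.2 e.1 e.2)

/-- `W` is a proper algebraic subset of the parameter set `T`: it is the set of points of `T`
where some family of polynomials in the matrix entries vanishes, and it is not all of `T`. -/
def IsProperAlgebraicSubset {V K : Type*} [CommRing K] (T W : Set (ParamPair V K)) : Prop :=
  (∃ S : Set (MvPolynomial ((V × V) ⊕ (V × V)) K),
    W = {θ | θ ∈ T ∧ ∀ f ∈ S, MvPolynomial.eval θ.coords f = 0}) ∧ W ≠ T

/-- The parametrization `(Λ, Ω) ↦ (I - Λ)⁻ᵀ Ω (I - Λ)⁻¹`. -/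
noncomputable def covarianceMap {V K : Type*} [Fintype V] [DecidableEq V] [CommRing K]
    (θ : ParamPair V K) : Matrix V V K :=
  ((1 - θ.1)⁻¹).transpose * θ.2 * (1 - θ.1)⁻¹

/-- The fiber through `θ` of the parametrization restricted to the parameter set `T`. -/
def covarianceFiber {V K : Type*} [Fintype V] [DecidableEq V] [CommRing K]
    (T : Set (ParamPair V K)) (θ : ParamPair V K) : Set (ParamPair V K) :=
  {θ' | θ' ∈ T ∧ covarianceMap θ' = covarianceMap θ}

/-- The parametrization restricted to `T` is generically `h`-to-one, `h ∈ ℕ ∪ {∞}`: outside a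
proper algebraic subset of `T`, the fiber through every point has exactly `h` elements. -/
def IsGenericallyToOne {V K : Type*} [Fintype V] [DecidableEq V] [CommRing K]
    (T : Set (ParamPair V K)) (h : ℕ∞) : Prop :=
  ∃ W : Set (ParamPair V K), IsProperAlgebraicSubset T W ∧
    ∀ θ ∈ T \ W, (covarianceFiber T θ).encard = h

namespace MixedGraph

variable {V : Type*}

/-- The directed part has no directed cycles. -/
def Acyclic (G : MixedGraph V) : Prop :=
  ∀ v, ¬ Relation.TransGen G.directed v v

/-- `K^D_reg`: matrices `Λ` supported on the directed edges with `I - Λ` invertible. -/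
def regMatrices (K : Type*) [CommRing K] [Fintype V] [DecidableEq V] (G : MixedGraph V) :
    Set (Matrix V V K) :=
  {L | (∀ v w, ¬ G.directed v w → L v w = 0) ∧ IsUnit (1 - L)}

/-- `PD(B)`: real positive definite (symmetric) matrices whose off-diagonal entries are supported
on the bidirected edges. -/
def posDefMatrices (G : MixedGraph V) : Set (Matrix V V ℝ) :=
  {O | O.PosDef ∧ ∀ v w, v ≠ w → ¬ G.bidirected.Adj v w → O v w = 0}

/-- Complex symmetric matrices whose off-diagonal entries are supported on the bidirected edges. -/
def symMatrices (G : MixedGraph V) : Set (Matrix V V ℂ) :=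
  {O | O.IsSymm ∧ ∀ v w, v ≠ w → ¬ G.bidirected.Adj v w → O v w = 0}

section Identifiability

variable [Fintype V] [DecidableEq V]

/-- The real parameter space `Θ = ℝ^D_reg × PD(B)`. -/
def realParams (G : MixedGraph V) : Set (ParamPair V ℝ) :=
  G.regMatrices ℝ ×ˢ G.posDefMatrices

/-- The complex parameter space. -/
def complexParams (G : MixedGraph V) : Set (ParamPair V ℂ) :=
  G.regMatrices ℂ ×ˢ G.symMatrices

/-- `G` is generically identifiable: the parametrization is injective on the complement of a
proper algebraic subset of `Θ`. -/
def GenericallyIdentifiable (G : MixedGraph V) : Prop :=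
  ∃ W : Set (ParamPair V ℝ), IsProperAlgebraicSubset G.realParams W ∧
    Set.InjOn covarianceMap (G.realParams \ W)

/-- `G` is rationally identifiable: outside a proper algebraic subset of `Θ`, the parameters are
recovered from the covariance matrix by a rational map, with coordinates `num i / den i`, that is
defined there. -/
def RationallyIdentifiable (G : MixedGraph V) : Prop :=
  ∃ W : Set (ParamPair V ℝ), IsProperAlgebraicSubset G.realParams W ∧
    ∃ num den : (V × V) ⊕ (V × V) → MvPolynomial (V × V) ℝ,
      ∀ θ ∈ G.realParams \ W, ∀ i,
        MvPolynomial.eval (fun e => covarianceMap θ e.1 e.2) (den i) ≠ 0 ∧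
        MvPolynomial.eval (fun e => covarianceMap θ e.1 e.2) (num i) /
          MvPolynomial.eval (fun e => covarianceMap θ e.1 e.2) (den i) = θ.coords i

/-- `G` is generically infinite-to-one: the (real) fibers through all points outside a proper
algebraic subset of `Θ` are infinite. -/
def GenericallyInfiniteToOne (G : MixedGraph V) : Prop :=
  ∃ W : Set (ParamPair V ℝ), IsProperAlgebraicSubset G.realParams W ∧
    ∀ θ ∈ G.realParams \ W, (covarianceFiber G.realParams θ).Infinite

/-- The degree of identifiability `ID(G)`: the (unique) `h ∈ ℕ ∪ {∞}` such that the complex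
parametrization is generically `h`-to-one. -/
noncomputable def identifiabilityDegree (G : MixedGraph V) : ℕ∞ :=
  sInf {h : ℕ∞ | IsGenericallyToOne G.complexParams h}

end Identifiability

/-- The index set of the mixed components: the connected components of the bidirected part. -/
def ComponentIndex (G : MixedGraph V) : Type _ := G.bidirected.ConnectedComponent

/-- The vertex set `C_j` of a connected component of the bidirected part. -/
def componentCore (G : MixedGraph V) (j : G.ComponentIndex) : Set V :=
  {v | G.bidirected.connectedComponentMk v = j}

/-- `V_j`: the set `C_j` together with all parents of nodes in `C_j`. -/
def componentVertices (G : MixedGraph V) (j : G.ComponentIndex) : Set V :=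
  G.componentCore j ∪ {p | ∃ v ∈ G.componentCore j, G.directed p v}

/-- The mixed component `G_j = (V_j, D_j, B_j)`, where `D_j` consists of the directed edges
`v → w` of `G` with `v ∈ V_j` and `w ∈ C_j`, and `B_j` of the bidirected edges of `G` inside
`C_j`. -/
def mixedComponent (G : MixedGraph V) (j : G.ComponentIndex) :
    MixedGraph (G.componentVertices j) where
  directed v w := G.directed v w ∧ (w : V) ∈ G.componentCore j
  directed_irrefl v h := G.directed_irrefl v h.1
  bidirected :=
    { Adj := fun v w => G.bidirected.Adj v w ∧ (v : V) ∈ G.componentCore j ∧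
        (w : V) ∈ G.componentCore j
      symm := ⟨fun _ _ h => ⟨h.1.symm, h.2.2, h.2.1⟩⟩
      loopless := ⟨fun _ h => G.bidirected.irrefl h.1⟩ }

noncomputable instance [Finite V] (G : MixedGraph V) : Fintype G.ComponentIndex :=
  letI : Finite G.bidirected.ConnectedComponent := Quot.finite _
  Fintype.ofFinite G.bidirected.ConnectedComponent

noncomputable instance [Finite V] (G : MixedGraph V) (j : G.ComponentIndex) :
    Fintype (G.componentVertices j) :=
  Fintype.ofFinite _

end MixedGraph

/-!
Order the vertices topologically. If `Ω = P⁻ᵀ diag(d) P⁻¹` with `P` unit upper triangular, then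
`S = (I - Λ)⁻ᵀ Ω (I - Λ)⁻¹` satisfies `Rᵀ S R = diag(d)` for the unit upper triangular matrix
`R = (I - Λ) P`, so `S` has LDL factor `R` and the same pivots as `Ω`. Since `Ω` is block diagonal
along the vertex sets `C_j`, so is `P`; hence the columns of `R` over `C_j` depend only on the
columns of `Λ` and the block of `Ω` over `C_j`, and the same columns occur in the LDL factor of the
covariance matrix of `G_j`. LDL factors are unique and rational in the matrix. Therefore, once the
variances in `G_j` of the parents outside `C_j` are fixed, the covariance matrix of `G` and the
tuple of covariance matrices of the `G_j` determine each other rationally: `φ_G` behaves like the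
product of the maps `φ_{G_j}`, and its fibers are products of theirs. Over `ℝ` every positive
definite matrix has an LDL decomposition, with positive pivots; over `ℂ` it exists where the
leading principal minors do not vanish, which is a generic condition.
-/

/-! ### Polynomial and rational functions -/

section PolynomialFunctions

variable {K X Y ι : Type*} [CommRing K]

/-- The algebra of functions on `X` that are polynomial in the coordinate functions `s i`. -/
def polyAlgebra (s : ι → X → K) : Subalgebra K (X → K) :=
  Algebra.adjoin K (Set.range s)

theorem coord_mem_polyAlgebra (s : ι → X → K) (i : ι) : s i ∈ polyAlgebra s :=
  Algebra.subset_adjoin ⟨i, rfl⟩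

theorem mem_polyAlgebra_iff {s : ι → X → K} {f : X → K} :
    f ∈ polyAlgebra s ↔
      ∃ p : MvPolynomial ι K, ∀ x, f x = MvPolynomial.eval (fun i => s i x) p := by
  have aeval_apply (p : MvPolynomial ι K) (x : X) :
      MvPolynomial.aeval s p x = MvPolynomial.eval (fun i => s i x) p :=
    MvPolynomial.comp_aeval_apply s (Pi.evalAlgHom K (fun _ => K) x) p
  simp only [polyAlgebra, Algebra.adjoin_range_eq_range_aeval, AlgHom.mem_range, funext_iff,
    aeval_apply, eq_comm]

theorem const_fun_mem (B : Subalgebra K (X → K)) (c : K) : (fun _ => c) ∈ B :=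
  B.algebraMap_mem c

theorem sum_fun_mem {κ : Type*} {B : Subalgebra K (X → K)} {s : Finset κ} {f : κ → X → K}
    (h : ∀ k ∈ s, f k ∈ B) : (fun x => ∑ k ∈ s, f k x) ∈ B :=
  Finset.sum_fn s f ▸ B.sum_mem h

theorem prod_fun_mem {κ : Type*} {B : Subalgebra K (X → K)} {s : Finset κ} {f : κ → X → K}
    (h : ∀ k ∈ s, f k ∈ B) : (fun x => ∏ k ∈ s, f k x) ∈ B :=
  Finset.prod_fn s f ▸ B.prod_mem h

theorem comp_mem_of_mem_polyAlgebra {s : ι → X → K} {B : Subalgebra K (Y → K)} {t : Y → X}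
    (h : ∀ i, s i ∘ t ∈ B) {f : X → K} (hf : f ∈ polyAlgebra s) : f ∘ t ∈ B := by
  induction hf using Algebra.adjoin_induction with
  | mem x hx => obtain ⟨i, rfl⟩ := hx; exact h i
  | algebraMap c => exact const_fun_mem B c
  | add f g _ _ hf hg => exact B.add_mem hf hg
  | mul f g _ _ hf hg => exact B.mul_mem hf hg

theorem exists_ne_zero_and_ne_zero_of_mem_polyAlgebra_id [IsDomain K] [Infinite K] {f g : K → K}
    (hf : f ∈ polyAlgebra fun _ : Unit => id) (hg : g ∈ polyAlgebra fun _ : Unit => id)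
    (hf₀ : ∃ t, f t ≠ 0) (hg₀ : ∃ t, g t ≠ 0) : ∃ t, f t ≠ 0 ∧ g t ≠ 0 := by
  obtain ⟨p, hp⟩ := mem_polyAlgebra_iff.1 hf
  obtain ⟨q, hq⟩ := mem_polyAlgebra_iff.1 hg
  have hp₀ : p ≠ 0 := by rintro rfl; simp [hp] at hf₀
  have hq₀ : q ≠ 0 := by rintro rfl; simp [hq] at hg₀
  obtain ⟨x, hx⟩ : ∃ x : Unit → K, MvPolynomial.eval x (p * q) ≠ 0 := by
    by_contra! h
    exact mul_ne_zero hp₀ hq₀ (MvPolynomial.funext fun x => by rw [h, map_zero])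
  rw [map_mul] at hx
  exact ⟨x (), hp (x ()) ▸ left_ne_zero_of_mul hx, hq (x ()) ▸ right_ne_zero_of_mul hx⟩

end PolynomialFunctions

section RationalFunctions

variable {K X Y ι κ : Type*} [Field K] {s : ι → X → K} {U : Set X}

/-- The algebra of functions on `X` that agree on `U` with a quotient of two polynomials in the
functions `s i`, the denominator having no zero in `U`. -/
def ratAlgebra (s : ι → X → K) (U : Set X) : Subalgebra K (X → K) where
  carrier := {g | ∃ n ∈ polyAlgebra s, ∃ d ∈ polyAlgebra s, ∀ x ∈ U, d x ≠ 0 ∧ n x / d x = g x}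
  mul_mem' := by
    rintro f g ⟨n, hn, d, hd, h⟩ ⟨n', hn', d', hd', h'⟩
    refine ⟨n * n', mul_mem hn hn', d * d', mul_mem hd hd', fun x hx =>
      ⟨mul_ne_zero (h x hx).1 (h' x hx).1, ?_⟩⟩
    simp only [Pi.mul_apply, ← (h x hx).2, ← (h' x hx).2, div_mul_div_comm]
  add_mem' := by
    rintro f g ⟨n, hn, d, hd, h⟩ ⟨n', hn', d', hd', h'⟩
    refine ⟨n * d' + d * n', add_mem (mul_mem hn hd') (mul_mem hd hn'), d * d',
      mul_mem hd hd', fun x hx => ⟨mul_ne_zero (h x hx).1 (h' x hx).1, ?_⟩⟩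
    simp only [Pi.mul_apply, Pi.add_apply, ← (h x hx).2, ← (h' x hx).2,
      div_add_div _ _ (h x hx).1 (h' x hx).1]
  algebraMap_mem' c := ⟨_, algebraMap_mem _ c, 1, one_mem _, fun x _ => by simp⟩

theorem polyAlgebra_le_ratAlgebra : polyAlgebra s ≤ ratAlgebra s U :=
  fun f hf => ⟨f, hf, 1, one_mem _, fun x _ => by simp⟩

theorem coord_mem_ratAlgebra (i : ι) : s i ∈ ratAlgebra s U :=
  polyAlgebra_le_ratAlgebra (coord_mem_polyAlgebra s i)

theorem mem_ratAlgebra_congr {f g : X → K} (h : U.EqOn f g) (hf : f ∈ ratAlgebra s U) :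
    g ∈ ratAlgebra s U := by
  obtain ⟨n, hn, d, hd, hnd⟩ := hf
  exact ⟨n, hn, d, hd, fun x hx => ⟨(hnd x hx).1, (hnd x hx).2.trans (h hx)⟩⟩

theorem inv_mem_ratAlgebra {f : X → K} (hf : f ∈ ratAlgebra s U) (h₀ : ∀ x ∈ U, f x ≠ 0) :
    f⁻¹ ∈ ratAlgebra s U := by
  obtain ⟨n, hn, d, hd, h⟩ := hf
  refine ⟨d, hd, n, hn, fun x hx => ⟨fun hnx => h₀ x hx ?_, ?_⟩⟩
  · rw [← (h x hx).2, hnx, zero_div]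
  · rw [Pi.inv_apply, ← (h x hx).2, inv_div]

theorem comp_mem_ratAlgebra {s' : κ → Y → K} {U' : Set Y} {t : Y → X} (ht : Set.MapsTo t U' U)
    (h : ∀ i, s i ∘ t ∈ ratAlgebra s' U') {f : X → K} (hf : f ∈ ratAlgebra s U) :
    f ∘ t ∈ ratAlgebra s' U' := by
  obtain ⟨n, hn, d, hd, hnd⟩ := hf
  refine mem_ratAlgebra_congr (fun y hy => ?_) (mul_mem (comp_mem_of_mem_polyAlgebra h hn)
    (inv_mem_ratAlgebra (comp_mem_of_mem_polyAlgebra h hd) fun y hy => (hnd _ (ht hy)).1))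
  rw [Function.comp_apply, ← (hnd _ (ht hy)).2, div_eq_mul_inv]
  rfl

end RationalFunctions

section MatrixFunctions

variable {K X l m n : Type*}

/-- The entries of a matrix-valued function on `X` belong to the algebra `B` of functions. -/
def EntriesIn [CommRing K] (B : Subalgebra K (X → K)) (M : X → Matrix m n K) : Prop :=
  ∀ i j, (fun x => M x i j) ∈ B

namespace EntriesIn

section CommRing

variable [CommRing K] {B : Subalgebra K (X → K)} {M : X → Matrix m n K}

theorem transpose (hM : EntriesIn B M) : EntriesIn B fun x => (M x).transpose :=
  fun i j => hM j i

theorem submatrix {m' n' : Type*} (hM : EntriesIn B M) (f : m' → m) (g : n' → n) :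
    EntriesIn B fun x => (M x).submatrix f g :=
  fun i j => hM (f i) (g j)

theorem diagonal [DecidableEq n] {d : X → n → K} (hd : ∀ i, (fun x => d x i) ∈ B) :
    EntriesIn B fun x => Matrix.diagonal (d x) := fun i j => by
  simp only [Matrix.diagonal_apply]
  split_ifs
  exacts [hd i, const_fun_mem B 0]

theorem mul [Fintype n] {N : X → Matrix n l K} (hM : EntriesIn B M) (hN : EntriesIn B N) :
    EntriesIn B fun x => M x * N x := fun i j => by
  simp only [Matrix.mul_apply]
  exact sum_fun_mem fun k _ => B.mul_mem (hM i k) (hN k j)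

theorem det [Fintype n] [DecidableEq n] {M : X → Matrix n n K} (hM : EntriesIn B M) :
    (fun x => (M x).det) ∈ B := by
  simp only [Matrix.det_apply']
  exact sum_fun_mem fun σ _ => B.mul_mem (const_fun_mem B _) (prod_fun_mem fun k _ => hM _ _)

end CommRing

theorem inv [Field K] [Fintype n] [DecidableEq n] {ι : Type*} {s : ι → X → K} {U : Set X}
    {M : X → Matrix n n K} (hM : EntriesIn (ratAlgebra s U) M) (h₀ : ∀ x ∈ U, (M x).det ≠ 0) :
    EntriesIn (ratAlgebra s U) fun x => (M x)⁻¹ := fun i j => by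
  simp only [Matrix.inv_def, Ring.inverse_eq_inv', Matrix.smul_apply, smul_eq_mul,
    Matrix.adjugate_apply]
  refine mul_mem (inv_mem_ratAlgebra hM.det h₀) (EntriesIn.det fun k l => ?_)
  simp only [Matrix.updateRow_apply]
  split_ifs
  exacts [const_fun_mem _ _, hM k l]

end EntriesIn

end MatrixFunctions

section BasicOpens

variable {K X Y ι κ : Type*} [CommRing K]

/-- The nonempty subsets of `T` on which a single function of the algebra `A` is nonzero. For `A`
the polynomial functions, these are the nonempty basic open sets of the Zariski topology, and a
property holds generically on `T` when it holds on one of them. -/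
def basicOpens (A : Subalgebra K (X → K)) (T : Set X) : Set (Set X) :=
  {U | U.Nonempty ∧ ∃ f ∈ A, U = {x ∈ T | f x ≠ 0}}

theorem subset_of_mem_basicOpens {A : Subalgebra K (X → K)} {T U : Set X}
    (hU : U ∈ basicOpens A T) : U ⊆ T := by
  obtain ⟨-, f, -, rfl⟩ := hU
  exact Set.sep_subset _ _

theorem preimage_mem_basicOpens {s : ι → X → K} {A' : Subalgebra K (Y → K)} {T : Set X}
    {T' : Set Y} {t : Y → X} (ht : Set.MapsTo t T' T) (hs : ∀ i, s i ∘ t ∈ A') {U : Set X}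
    (hU : U ∈ basicOpens (polyAlgebra s) T) (hne : ∃ y ∈ T', t y ∈ U) :
    {y ∈ T' | t y ∈ U} ∈ basicOpens A' T' := by
  obtain ⟨-, f, hf, rfl⟩ := hU
  exact ⟨hne, f ∘ t, comp_mem_of_mem_polyAlgebra hs hf, Set.ext fun y =>
    and_congr_right fun hy => and_iff_right (ht hy)⟩

theorem exists_mem_basicOpens_sep_iff [IsDomain K] {A : Subalgebra K (X → K)} {T : Set X}
    {e : X → K} (he : e ∈ A) (hdense : ∀ U ∈ basicOpens A T, ∃ x ∈ U, e x ≠ 0)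
    {Q : Set X → Prop} (hQ : Antitone Q) :
    (∃ U ∈ basicOpens A T, Q U) ↔ ∃ U ∈ basicOpens A {x ∈ T | e x ≠ 0}, Q U := by
  constructor
  · rintro ⟨U, hU, hQU⟩
    obtain ⟨x, hxU, hx⟩ := hdense U hU
    obtain ⟨-, f, hf, rfl⟩ := hU
    exact ⟨{x ∈ {x ∈ T | e x ≠ 0} | f x ≠ 0}, ⟨⟨x, ⟨hxU.1, hx⟩, hxU.2⟩, f, hf, rfl⟩,
      hQ (Set.ofPred_subset_ofPred.2 fun y hy => ⟨hy.1.1, hy.2⟩) hQU⟩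
  · rintro ⟨_, ⟨hne, f, hf, rfl⟩, hQU⟩
    refine ⟨{x ∈ {x ∈ T | e x ≠ 0} | f x ≠ 0},
      ⟨hne, e * f, mul_mem he hf, Set.ext fun x => ?_⟩, hQU⟩
    exact and_assoc.trans (and_congr_right fun _ => mul_ne_zero_iff.symm)

end BasicOpens

/-! ### Generic properties on products -/

section Products

variable {K ι : Type*} {κ Y : ι → Type*}

/-- The coordinate functions on a product of spaces with coordinate functions `s i`. -/
def piCoords (s : ∀ i, κ i → Y i → K) : (Σ i, κ i) → (∀ i, Y i) → K :=
  fun c η => s c.1 c.2 (η c.1)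

theorem piCoords_comp_update_mem {Z : Type*} [CommRing K] {s : ∀ i, κ i → Y i → K}
    [DecidableEq ι] {i : ι} {t : Z → Y i} {B : Subalgebra K (Z → K)} (η : ∀ i, Y i)
    (h : ∀ c, s i c ∘ t ∈ B) (c : Σ i, κ i) :
    piCoords s c ∘ (fun z => Function.update η i (t z)) ∈ B := by
  obtain ⟨k, c⟩ := c
  obtain rfl | hk := eq_or_ne k i
  · simpa [piCoords, Function.comp_def] using h c
  · simpa [piCoords, Function.comp_def, hk] using const_fun_mem B _

theorem update_mem_pi [DecidableEq ι] {T : ∀ i, Set (Y i)} {η : ∀ i, Y i}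
    (hη : η ∈ Set.pi Set.univ T) {i : ι} {y : Y i} (hy : y ∈ T i) :
    Function.update η i y ∈ Set.pi Set.univ T := by
  rw [Set.update_mem_pi_iff_of_mem hη]
  exact fun _ => hy

section BasicOpens

variable [CommRing K] {s : ∀ i, κ i → Y i → K} {T : ∀ i, Set (Y i)}

theorem slice_mem_basicOpens [DecidableEq ι] {U : Set (∀ i, Y i)}
    (hU : U ∈ basicOpens (polyAlgebra (piCoords s)) (Set.pi Set.univ T)) {η : ∀ i, Y i}
    (hη : η ∈ U) (i : ι) :
    {y ∈ T i | Function.update η i y ∈ U} ∈ basicOpens (polyAlgebra (s i)) (T i) := by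
  have hηT := subset_of_mem_basicOpens hU hη
  refine preimage_mem_basicOpens (fun y hy => update_mem_pi hηT hy)
    (piCoords_comp_update_mem η (coord_mem_polyAlgebra (s i))) hU ⟨η i, hηT i trivial, ?_⟩
  rwa [Function.update_eq_self]

theorem eval_preimage_mem_basicOpens (hne : (Set.pi Set.univ T).Nonempty) {i : ι} {U : Set (Y i)}
    (hU : U ∈ basicOpens (polyAlgebra (s i)) (T i)) :
    {η ∈ Set.pi Set.univ T | η i ∈ U} ∈
      basicOpens (polyAlgebra (piCoords s)) (Set.pi Set.univ T) := by
  classical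
  obtain ⟨η, hη⟩ := hne
  obtain ⟨y, hy⟩ := hU.1
  refine preimage_mem_basicOpens (T' := Set.pi Set.univ T) (fun η hη => hη i trivial)
    (fun c => coord_mem_polyAlgebra (piCoords s) ⟨i, c⟩) hU
    ⟨Function.update η i y, update_mem_pi hη (subset_of_mem_basicOpens hU hy), ?_⟩
  rwa [Function.update_self]

theorem pi_mem_basicOpens [Finite ι] [IsDomain K] {U : ∀ i, Set (Y i)}
    (hU : ∀ i, U i ∈ basicOpens (polyAlgebra (s i)) (T i)) :
    Set.pi Set.univ U ∈ basicOpens (polyAlgebra (piCoords s)) (Set.pi Set.univ T) := by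
  have := Fintype.ofFinite ι
  refine ⟨Set.univ_pi_nonempty_iff.2 fun i => (hU i).1, ?_⟩
  choose _ f hf hUf using hU
  refine ⟨fun η => ∏ i, f i (η i), prod_fun_mem fun i _ =>
    comp_mem_of_mem_polyAlgebra (fun c => coord_mem_polyAlgebra (piCoords s) ⟨i, c⟩) (hf i), ?_⟩
  ext η
  simp [hUf, Finset.prod_ne_zero_iff, forall_and]

theorem exists_mem_inter_pi [Finite ι] {Q : ∀ i, Set (Y i)}
    (hQ : ∀ i, ∀ U ∈ basicOpens (polyAlgebra (s i)) (T i), (U ∩ Q i).Nonempty)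
    {U : Set (∀ i, Y i)} (hU : U ∈ basicOpens (polyAlgebra (piCoords s)) (Set.pi Set.univ T)) :
    (U ∩ Set.pi Set.univ Q).Nonempty := by
  classical
  have := Fintype.ofFinite ι
  suffices h : ∀ J : Finset ι, ∃ η ∈ U, ∀ i ∈ J, η i ∈ Q i by
    obtain ⟨η, hη, hηQ⟩ := h Finset.univ
    exact ⟨η, hη, fun i _ => hηQ i (Finset.mem_univ i)⟩
  intro J
  induction J using Finset.induction_on with
  | empty => exact hU.1.imp fun η hη => ⟨hη, by simp⟩
  | insert i J _ ih =>
    obtain ⟨η, hη, hηQ⟩ := ih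
    obtain ⟨y, ⟨-, hyU⟩, hyQ⟩ := hQ i _ (slice_mem_basicOpens hU hη i)
    refine ⟨_, hyU, fun k hk => ?_⟩
    obtain rfl | hki := eq_or_ne k i
    · rwa [Function.update_self]
    · rw [Function.update_of_ne hki]
      exact hηQ k (Finset.mem_of_mem_insert_of_ne hk hki)

section Cardinality

variable [Fintype ι] {N : ∀ i, Y i → ℕ∞}

theorem exists_prod_eq_of_forall [IsDomain K] {h : ι → ℕ∞}
    (hN : ∀ i, ∃ U ∈ basicOpens (polyAlgebra (s i)) (T i), ∀ y ∈ U, N i y = h i) :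
    ∃ U ∈ basicOpens (polyAlgebra (piCoords s)) (Set.pi Set.univ T),
      ∀ η ∈ U, ∏ i, N i (η i) = ∏ i, h i := by
  choose U hU hUh using hN
  exact ⟨_, pi_mem_basicOpens hU, fun η hη =>
    Finset.prod_congr rfl fun i _ => hUh i _ (hη i trivial)⟩

theorem exists_prod_eq_top_iff (hne : (Set.pi Set.univ T).Nonempty)
    (hN₀ : ∀ i, ∀ y ∈ T i, N i y ≠ 0) :
    (∃ U ∈ basicOpens (polyAlgebra (piCoords s)) (Set.pi Set.univ T),
      ∀ η ∈ U, ∏ i, N i (η i) = ⊤) ↔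
      ∃ i, ∃ U ∈ basicOpens (polyAlgebra (s i)) (T i), ∀ y ∈ U, N i y = ⊤ := by
  constructor
  · rintro ⟨U, hU, hUN⟩
    by_contra! hfin
    obtain ⟨η, hη, hηN⟩ := exists_mem_inter_pi (Q := fun i => {y | N i y ≠ ⊤}) hfin hU
    obtain ⟨i, -, hi⟩ := WithTop.prod_eq_top_ex_top (hUN η hη)
    exact hηN i trivial hi
  · rintro ⟨i, U, hU, hUN⟩
    exact ⟨_, eval_preimage_mem_basicOpens hne hU, fun η hη => WithTop.prod_eq_top
      (Finset.mem_univ i) (hUN _ hη.2) fun k _ => hN₀ k _ (hη.1 k trivial)⟩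

theorem exists_forall_of_prod_eq (hN₀ : ∀ i, ∀ y ∈ T i, N i y ≠ 0) {h : ℕ∞} (hh : h ≠ ⊤)
    (hN : ∃ U ∈ basicOpens (polyAlgebra (piCoords s)) (Set.pi Set.univ T),
      ∀ η ∈ U, ∏ i, N i (η i) = h) :
    ∃ h' : ι → ℕ∞, ∏ i, h' i = h ∧
      ∀ i, ∃ U ∈ basicOpens (polyAlgebra (s i)) (T i), ∀ y ∈ U, N i y = h' i := by
  classical
  obtain ⟨U, hU, hUN⟩ := hN
  obtain ⟨η, hη⟩ := hU.1
  have hη₀ i : N i (η i) ≠ 0 := hN₀ i _ (subset_of_mem_basicOpens hU hη i trivial)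
  refine ⟨fun i => N i (η i), hUN η hη, fun i => ⟨_, slice_mem_basicOpens hU hη i, fun y hy => ?_⟩⟩
  set c := ∏ k ∈ Finset.univ.erase i, N k (η k) with hc
  have hη_eq : N i (η i) * c = h := by
    rw [hc, Finset.mul_prod_erase _ (fun k => N k (η k)) (Finset.mem_univ i), hUN η hη]
  have hy_eq : N i y * c = h := by
    rw [← hUN _ hy.2, ← Finset.mul_prod_erase _ _ (Finset.mem_univ i), Function.update_self]
    congr 1
    exact Finset.prod_congr rfl fun k hk => by
      rw [Function.update_of_ne (Finset.ne_of_mem_erase hk)]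
  have hc₀ : c ≠ 0 := Finset.prod_ne_zero_iff.2 fun k _ => hη₀ k
  have hct : c ≠ ⊤ := fun hct => hh <| by rw [← hη_eq, hct, ENat.mul_top (hη₀ i)]
  exact (ENat.mul_left_strictMono hc₀ hct).injective (hy_eq.trans hη_eq.symm)

theorem sInf_prod_eq [IsDomain K] (hN₀ : ∀ i, ∀ y ∈ T i, N i y ≠ 0) :
    sInf {h | ∃ U ∈ basicOpens (polyAlgebra (piCoords s)) (Set.pi Set.univ T),
      ∀ η ∈ U, ∏ i, N i (η i) = h} =
    ∏ i, sInf {h | ∃ U ∈ basicOpens (polyAlgebra (s i)) (T i), ∀ y ∈ U, N i y = h} := by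
  set S : ι → Set ℕ∞ := fun i =>
    {h | ∃ U ∈ basicOpens (polyAlgebra (s i)) (T i), ∀ y ∈ U, N i y = h}
  have mem_of_ne_top {i} (hi : sInf (S i) ≠ ⊤) : sInf (S i) ∈ S i :=
    csInf_mem <| Set.nonempty_iff_ne_empty.2 fun h => hi <| by rw [h, sInf_empty]
  have sInf_ne_zero i : sInf (S i) ≠ 0 := fun h₀ => by
    obtain ⟨U, hU, hUN⟩ := mem_of_ne_top (i := i) (by simp [h₀])
    obtain ⟨y, hy⟩ := hU.1
    exact hN₀ i y (subset_of_mem_basicOpens hU hy) ((hUN y hy).trans h₀)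
  refine le_antisymm ?_ (le_sInf fun h hh => ?_)
  · by_cases htop : ∃ i, sInf (S i) = ⊤
    · obtain ⟨i, hi⟩ := htop
      exact le_top.trans_eq (WithTop.prod_eq_top (Finset.mem_univ i) hi fun k _ =>
        sInf_ne_zero k).symm
    · exact sInf_le (exists_prod_eq_of_forall fun i => mem_of_ne_top (not_exists.1 htop i))
  · obtain rfl | hh_top := eq_or_ne h ⊤
    · exact le_top
    · obtain ⟨h', rfl, hh'⟩ := exists_forall_of_prod_eq hN₀ hh_top hh
      exact Finset.prod_le_prod' fun i _ => sInf_le (hh' i)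

end Cardinality

theorem exists_injOn_pi_iff [Finite ι] [IsDomain K] {Z : ι → Type*} {φ : ∀ i, Y i → Z i} :
    (∃ U ∈ basicOpens (polyAlgebra (piCoords s)) (Set.pi Set.univ T),
      Set.InjOn (fun η i => φ i (η i)) U) ↔
      ∀ i, ∃ U ∈ basicOpens (polyAlgebra (s i)) (T i), Set.InjOn (φ i) U := by
  classical
  constructor
  · rintro ⟨U, hU, hinj⟩ i
    obtain ⟨η, hη⟩ := hU.1
    refine ⟨_, slice_mem_basicOpens hU hη i, fun y hy y' hy' heq => ?_⟩
    refine Function.update_injective η i (hinj hy.2 hy'.2 (funext fun k => ?_))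
    dsimp only
    rw [Function.apply_update φ, Function.apply_update φ, heq]
  · intro h
    choose U hU hinj using h
    exact ⟨_, pi_mem_basicOpens hU, fun η hη η' hη' heq => funext fun i =>
      hinj i (hη i trivial) (hη' i trivial) (congrFun heq i)⟩

end BasicOpens

theorem exists_coord_mem_ratAlgebra_pi_iff [Field K] [Finite ι] {s : ∀ i, κ i → Y i → K}
    {T : ∀ i, Set (Y i)} {κ' : ι → Type*} {φ : ∀ i, κ' i → Y i → K} :
    (∃ U ∈ basicOpens (polyAlgebra (piCoords s)) (Set.pi Set.univ T),
      ∀ c, piCoords s c ∈ ratAlgebra (piCoords φ) U) ↔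
      ∀ i, ∃ U ∈ basicOpens (polyAlgebra (s i)) (T i), ∀ c, s i c ∈ ratAlgebra (φ i) U := by
  classical
  constructor
  · rintro ⟨U, hU, hrat⟩ i
    obtain ⟨η, hη⟩ := hU.1
    refine ⟨_, slice_mem_basicOpens hU hη i, fun c => ?_⟩
    have h := comp_mem_ratAlgebra (fun y (hy : y ∈ {y ∈ T i | Function.update η i y ∈ U}) => hy.2)
      (piCoords_comp_update_mem (s := φ) η fun _ => coord_mem_ratAlgebra _) (hrat ⟨i, c⟩)
    simpa [piCoords, Function.comp_def] using h
  · intro h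
    choose U hU hrat using h
    exact ⟨_, pi_mem_basicOpens hU, fun ⟨i, c⟩ =>
      comp_mem_ratAlgebra (t := fun η : ∀ i, Y i => η i) (U' := Set.pi Set.univ U)
        (fun η hη => hη i trivial) (fun c => coord_mem_ratAlgebra (s := piCoords φ) ⟨i, c⟩)
        (hrat i c)⟩

end Products

/-! ### The LDL decomposition -/

section LDL

open Matrix

variable {V α K : Type*} [LinearOrder α] [Field K] {r : V → α}

/-- Unit upper triangular matrices for the order on the index set given by the rank `r`. -/
structure IsUnitUpper (r : V → α) (R : Matrix V V K) : Prop where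
  tri : R.BlockTriangular r
  diag : ∀ v, R v v = 1

theorem IsUnitUpper.one_sub [DecidableEq V] {L : Matrix V V K}
    (hL : ∀ u v, r v ≤ r u → L u v = 0) : IsUnitUpper r (1 - L) where
  tri u v h := by
    have huv : u ≠ v := by rintro rfl; exact lt_irrefl _ h
    simp [hL u v h.le, huv]
  diag v := by simp [hL v v le_rfl]

variable [Fintype V]

theorem submatrix_val_mul {p : V → Prop} [DecidablePred p] {M N : Matrix V V K}
    (h : ∀ u w v, p u → ¬ p w → p v → M u w * N w v = 0) :
    (M * N).submatrix (Subtype.val : Subtype p → V) (Subtype.val : Subtype p → V) =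
      M.submatrix Subtype.val Subtype.val * N.submatrix Subtype.val Subtype.val := by
  ext u v
  simp only [submatrix_apply, mul_apply]
  rw [← Fintype.sum_subtype_add_sum_subtype p, add_eq_left]
  exact Finset.sum_eq_zero fun w _ => h u w v u.2 w.2 v.2

theorem mul_apply_self_of_blockTriangular (hr : r.Injective) {M N : Matrix V V K}
    (hM : M.BlockTriangular r) (hN : N.BlockTriangular r) (v : V) :
    (M * N) v v = M v v * N v v := by
  rw [mul_apply]
  refine Fintype.sum_eq_single v fun w hw => ?_
  obtain h | h := lt_or_gt_of_ne (hr.ne hw)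
  · rw [hM h, zero_mul]
  · rw [hN h, mul_zero]

theorem IsUnitUpper.mul (hr : r.Injective) {M N : Matrix V V K} (hM : IsUnitUpper r M)
    (hN : IsUnitUpper r N) : IsUnitUpper r (M * N) :=
  ⟨hM.tri.mul hN.tri, fun v => by
    rw [mul_apply_self_of_blockTriangular hr hM.tri hN.tri, hM.diag, hN.diag, one_mul]⟩

variable [DecidableEq V]

namespace IsUnitUpper

variable {M N : Matrix V V K}

theorem det_eq_one (hr : r.Injective) (hM : IsUnitUpper r M) : M.det = 1 := by
  let : LinearOrder V := LinearOrder.lift' r hr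
  have h : M.IsUpperTriangular := fun i j hij => hM.tri hij
  rw [det_of_isUpperTriangular h]
  exact Finset.prod_eq_one fun v _ => hM.diag v

theorem isUnit_det (hr : r.Injective) (hM : IsUnitUpper r M) : IsUnit M.det := by
  rw [hM.det_eq_one hr]
  exact isUnit_one

theorem inv (hr : r.Injective) (hM : IsUnitUpper r M) : IsUnitUpper r M⁻¹ := by
  have hu := hM.isUnit_det hr
  let := invertibleOfIsUnitDet M hu
  have htri : M⁻¹.BlockTriangular r := blockTriangular_inv_of_blockTriangular hM.tri
  refine ⟨htri, fun v => ?_⟩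
  have h := mul_apply_self_of_blockTriangular hr htri hM.tri v
  rwa [nonsing_inv_mul _ hu, hM.diag, mul_one, one_apply_eq, eq_comm] at h

theorem eq_one_of_transpose_mul_diagonal_mul (hr : r.Injective) (hM : IsUnitUpper r M)
    {d d' : V → K} (hd : ∀ v, d v ≠ 0) (h : Mᵀ * diagonal d * M = diagonal d') : M = 1 := by
  have hu : IsUnit Mᵀ.det := by rw [det_transpose]; exact hM.isUnit_det hr
  have lower_eq_upper : diagonal d * M = M⁻¹ᵀ * diagonal d' := by
    rw [← h, transpose_nonsing_inv, Matrix.mul_assoc, nonsing_inv_mul_cancel_left _ _ hu]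
  ext u v
  obtain rfl | huv := eq_or_ne u v
  · rw [hM.diag, one_apply_eq]
  rw [one_apply_ne huv]
  obtain hlt | hlt := lt_or_gt_of_ne (hr.ne huv)
  · have huv₀ := congrFun (congrFun lower_eq_upper u) v
    rw [diagonal_mul, mul_diagonal, transpose_apply, (hM.inv hr).tri hlt, zero_mul] at huv₀
    exact (mul_eq_zero.1 huv₀).resolve_left (hd u)
  · exact hM.tri hlt

end IsUnitUpper

/-- The `LDL` decomposition `S = R⁻ᵀ D R⁻¹`, in the inverse-free form `Rᵀ S R = D`: the matrix `R`
is unit upper triangular and `D` is the diagonal matrix of the nonzero pivots `d`. -/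
structure IsLDL (r : V → α) (S R : Matrix V V K) (d : V → K) : Prop extends IsUnitUpper r R where
  eq : Rᵀ * S * R = diagonal d
  ne : ∀ v, d v ≠ 0

theorem isLDL_iff {S R : Matrix V V K} {d : V → K} :
    IsLDL r S R d ↔ IsUnitUpper r R ∧ Rᵀ * S * R = diagonal d ∧ ∀ v, d v ≠ 0 :=
  ⟨fun h => ⟨h.toIsUnitUpper, h.eq, h.ne⟩, fun ⟨h, heq, hne⟩ => ⟨h, heq, hne⟩⟩

namespace IsLDL

variable {S S' R R' : Matrix V V K} {d d' : V → K}

theorem eq_inv (hr : r.Injective) (h : IsLDL r S R d) : S = R⁻¹ᵀ * diagonal d * R⁻¹ := by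
  have hu := h.isUnit_det hr
  have hu' : IsUnit Rᵀ.det := by rwa [det_transpose]
  rw [← h.eq, transpose_nonsing_inv, Matrix.mul_assoc Rᵀ, nonsing_inv_mul_cancel_left _ _ hu',
    mul_nonsing_inv_cancel_right _ _ hu]

theorem eq_of_eq (hr : r.Injective) (h : IsLDL r S R d) (h' : IsLDL r S' R d) : S = S' :=
  (h.eq_inv hr).trans (h'.eq_inv hr).symm

theorem isSymm (hr : r.Injective) (h : IsLDL r S R d) : S.IsSymm := by
  rw [Matrix.IsSymm, h.eq_inv hr]
  simp only [transpose_mul, transpose_transpose, diagonal_transpose, Matrix.mul_assoc]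

theorem det_eq_prod (hr : r.Injective) (h : IsLDL r S R d) : S.det = ∏ v, d v := by
  have hdet := congrArg det h.eq
  rwa [det_mul, det_mul, det_transpose, h.det_eq_one hr, one_mul, mul_one, det_diagonal] at hdet

theorem unique (hr : r.Injective) (h : IsLDL r S R d) (h' : IsLDL r S R' d') :
    R = R' ∧ d = d' := by
  have hR' : R' = R * (R⁻¹ * R') := (mul_nonsing_inv_cancel_left _ _ (h.isUnit_det hr)).symm
  have hdiag : (R⁻¹ * R')ᵀ * diagonal d * (R⁻¹ * R') = diagonal d' := by
    rw [← h.eq, ← h'.eq]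
    conv_rhs => rw [hR', transpose_mul]
    simp only [Matrix.mul_assoc]
  have hunit := (h.toIsUnitUpper.inv hr).mul hr h'.toIsUnitUpper
  have hone := hunit.eq_one_of_transpose_mul_diagonal_mul hr h.ne hdiag
  rw [hone, transpose_one, Matrix.mul_one, Matrix.one_mul] at hdiag
  exact ⟨by rw [hR', hone, Matrix.mul_one], diagonal_injective hdiag⟩

theorem conj_sign (h : IsLDL r S R d) {t : V → K} (ht : ∀ v, t v * t v = 1)
    (htS : diagonal t * S * diagonal t = S) : IsLDL r S (diagonal t * R * diagonal t) d where
  tri a b hab := by rw [mul_diagonal, diagonal_mul, h.tri hab, mul_zero, zero_mul]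
  diag a := by rw [mul_diagonal, diagonal_mul, h.diag, mul_one, ht]
  eq := calc
    (diagonal t * R * diagonal t)ᵀ * S * (diagonal t * R * diagonal t)
      = diagonal t * (Rᵀ * (diagonal t * S * diagonal t) * R) * diagonal t := by
        simp only [transpose_mul, diagonal_transpose, Matrix.mul_assoc]
    _ = diagonal d := by
        rw [htS, h.eq, diagonal_mul_diagonal, diagonal_mul_diagonal]
        exact congrArg diagonal (funext fun v => by rw [mul_right_comm, ht, one_mul])
  ne := h.ne

/-- Changing the sign of one block preserves `S`, hence, by uniqueness, its decomposition. -/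
theorem apply_eq_zero_of_block [NeZero (2 : K)] (hr : r.Injective) (h : IsLDL r S R d)
    {β : Type*} {c : V → β} (hS : ∀ u v, c u ≠ c v → S u v = 0) {u v : V} (huv : c u ≠ c v) :
    R u v = 0 := by
  classical
  set t : V → K := fun w => if c w = c u then 1 else -1 with ht
  have t_sq w : t w * t w = 1 := by simp only [ht]; split_ifs <;> simp
  have conj_S : diagonal t * S * diagonal t = S := by
    ext a b
    rw [mul_diagonal, diagonal_mul]
    by_cases hab : c a = c b
    · have : t a = t b := by simp only [ht, hab]
      rw [this, mul_right_comm, t_sq, one_mul]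
    · rw [hS a b hab, mul_zero, zero_mul]
  have huv_neg := congrFun (congrFun (h.unique hr (h.conj_sign t_sq conj_S)).1 u) v
  rw [mul_diagonal, diagonal_mul, show t u = 1 from if_pos rfl, show t v = -1 from if_neg huv.symm]
    at huv_neg
  have two_mul_eq : (2 : K) * R u v = 0 := by linear_combination huv_neg
  exact (mul_eq_zero.1 two_mul_eq).resolve_left two_ne_zero

theorem pivot_eq_apply_self [NeZero (2 : K)] (hr : r.Injective) (h : IsLDL r S R d) {p : V}
    (hp : ∀ v, v ≠ p → S v p = 0) : d p = S p p := by
  have hRp {v} (hv : v ≠ p) : R v p = 0 := by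
    refine h.apply_eq_zero_of_block hr (c := (· = p)) (fun a b hab => ?_) (by simpa using hv)
    by_cases hb : b = p
    · exact hb ▸ hp a fun ha => hab (by simp only [ha, hb])
    · have ha : a = p := by simpa [hb] using hab
      rw [← (h.isSymm hr).apply, ha, hp b hb]
  have hpp := congrFun (congrFun h.eq p) p
  rw [diagonal_apply_eq, mul_apply, Fintype.sum_eq_single p fun v hv => by rw [hRp hv, mul_zero],
    mul_apply, Fintype.sum_eq_single p fun v hv => by rw [transpose_apply, hRp hv, zero_mul],
    transpose_apply, h.diag, one_mul, mul_one] at hpp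
  exact hpp.symm

end IsLDL

/-- The leading principal submatrix on the indices preceding `v`. -/
def leadingSubmatrix (r : V → α) (S : Matrix V V K) (v : V) :
    Matrix {w // r w < r v} {w // r w < r v} K :=
  S.submatrix Subtype.val Subtype.val

/-- The product of the determinant and of all leading principal minors. -/
noncomputable def minorProd (r : V → α) (S : Matrix V V K) : K :=
  S.det * ∏ v, (leadingSubmatrix r S v).det

theorem minorProd_one_ne_zero : minorProd r (1 : Matrix V V K) ≠ 0 := by
  simp [minorProd, leadingSubmatrix, Matrix.submatrix_one _ Subtype.val_injective]

/-- The unit upper triangular factor of the `LDL` decomposition, by Cramer's rule. -/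
noncomputable def ldlFactor (r : V → α) (S : Matrix V V K) : Matrix V V K :=
  fun u v => if u = v then 1 else if h : r u < r v then
    -((leadingSubmatrix r S v)⁻¹ *ᵥ fun w => S w v) ⟨u, h⟩ else 0

/-- The diagonal part of the `LDL` decomposition with factor `ldlFactor r S`. -/
noncomputable def ldlPivots (r : V → α) (S : Matrix V V K) (v : V) : K :=
  ((ldlFactor r S)ᵀ * S * ldlFactor r S) v v

theorem isUnitUpper_ldlFactor (S : Matrix V V K) : IsUnitUpper r (ldlFactor r S) where
  tri u v h := by
    have huv : u ≠ v := by rintro rfl; exact lt_irrefl _ h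
    simp only [ldlFactor, if_neg huv, dif_neg h.not_gt]
  diag v := by simp only [ldlFactor, if_pos]

theorem mul_ldlFactor_apply {S : Matrix V V K} {u v : V} (huv : r u < r v)
    (h : (leadingSubmatrix r S v).det ≠ 0) : (S * ldlFactor r S) u v = 0 := by
  rw [mul_apply, ← Fintype.sum_subtype_add_sum_subtype (fun w => r w < r v)]
  have sum_ge : ∑ w : {w // ¬ r w < r v}, S u w * ldlFactor r S w v = S u v := by
    rw [Fintype.sum_eq_single ⟨v, lt_irrefl _⟩]
    · simp [ldlFactor]
    · rintro ⟨w, hw⟩ hwv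
      have hne : w ≠ v := fun hh => hwv (Subtype.ext hh)
      simp [ldlFactor, hw, hne]
  have sum_lt : ∑ w : {w // r w < r v}, S u w * ldlFactor r S w v =
      -(leadingSubmatrix r S v *ᵥ ((leadingSubmatrix r S v)⁻¹ *ᵥ fun w => S w v)) ⟨u, huv⟩ := by
    rw [mulVec, dotProduct, ← Finset.sum_neg_distrib]
    refine Finset.sum_congr rfl fun w _ => ?_
    have hne : (w : V) ≠ v := fun hw => w.2.ne (congrArg r hw)
    simp only [ldlFactor, if_neg hne, dif_pos w.2, leadingSubmatrix, submatrix_apply, mul_neg]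
  rw [sum_ge, sum_lt, mulVec_mulVec, mul_nonsing_inv _ (isUnit_iff_ne_zero.2 h), one_mulVec,
    neg_add_cancel]

theorem transpose_ldlFactor_mul_mul_ldlFactor (hr : r.Injective) {S : Matrix V V K}
    (hS : S.IsSymm) (h : ∀ v, (leadingSubmatrix r S v).det ≠ 0) :
    (ldlFactor r S)ᵀ * S * ldlFactor r S = diagonal (ldlPivots r S) := by
  set D := (ldlFactor r S)ᵀ * S * ldlFactor r S with hD
  have symm_D : Dᵀ = D := by
    simp only [hD, transpose_mul, transpose_transpose, hS.eq, Matrix.mul_assoc]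
  have lt_eq_zero u v (huv : r u < r v) : D u v = 0 := by
    rw [hD, Matrix.mul_assoc, mul_apply]
    refine Finset.sum_eq_zero fun w _ => ?_
    by_cases hw : r w < r v
    · rw [mul_ldlFactor_apply hw (h v), mul_zero]
    · rw [transpose_apply, (isUnitUpper_ldlFactor S).tri (huv.trans_le (not_lt.1 hw)), zero_mul]
  ext u v
  obtain rfl | huv := eq_or_ne u v
  · rw [diagonal_apply_eq, ldlPivots]
  rw [diagonal_apply_ne _ huv]
  obtain hlt | hlt := lt_or_gt_of_ne (hr.ne huv)
  · exact lt_eq_zero u v hlt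
  · rw [← symm_D, transpose_apply, lt_eq_zero v u hlt]

theorem isLDL_ldlFactor (hr : r.Injective) {S : Matrix V V K} (hS : S.IsSymm)
    (h : minorProd r S ≠ 0) : IsLDL r S (ldlFactor r S) (ldlPivots r S) := by
  have hminor v := Finset.prod_ne_zero_iff.1 (right_ne_zero_of_mul h) v (Finset.mem_univ v)
  have heq := transpose_ldlFactor_mul_mul_ldlFactor hr hS hminor
  refine ⟨isUnitUpper_ldlFactor S, heq, fun v hv => left_ne_zero_of_mul h ?_⟩
  have hdet := congrArg det heq
  rw [det_mul, det_mul, det_transpose, (isUnitUpper_ldlFactor S).det_eq_one hr, one_mul, mul_one,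
    det_diagonal] at hdet
  rw [hdet, Finset.prod_eq_zero (Finset.mem_univ v) hv]

namespace IsLDL

variable {S R : Matrix V V K} {d : V → K}

theorem leadingSubmatrix (h : IsLDL r S R d) (v : V) :
    IsLDL (fun w : {w // r w < r v} => r w) (leadingSubmatrix r S v) (leadingSubmatrix r R v)
      (fun w => d w) where
  tri a b hab := h.tri hab
  diag a := h.diag a
  eq := by
    have hR {w u} (hw : ¬ r w < r v) (hu : r u < r v) : R w u = 0 :=
      h.tri (hu.trans_le (not_lt.1 hw))
    have heq := congrArg (fun M : Matrix V V K => M.submatrix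
      (Subtype.val : {w // r w < r v} → V) (Subtype.val : {w // r w < r v} → V)) h.eq
    rw [submatrix_val_mul fun u w x _ hw hx => by rw [hR hw hx, mul_zero],
      submatrix_val_mul fun u w x hu hw _ => by rw [transpose_apply, hR hw hu, zero_mul],
      submatrix_diagonal _ _ Subtype.val_injective] at heq
    exact heq
  ne w := h.ne w

theorem minorProd_ne_zero (hr : r.Injective) (h : IsLDL r S R d) : minorProd r S ≠ 0 := by
  refine mul_ne_zero ?_ (Finset.prod_ne_zero_iff.2 fun v _ => ?_)
  · rw [h.det_eq_prod hr]
    exact Finset.prod_ne_zero_iff.2 fun v _ => h.ne v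
  · rw [(h.leadingSubmatrix v).det_eq_prod (hr.comp Subtype.val_injective)]
    exact Finset.prod_ne_zero_iff.2 fun w _ => h.ne w

theorem isLDL_ldlFactor (hr : r.Injective) (h : IsLDL r S R d) :
    IsLDL r S (ldlFactor r S) (ldlPivots r S) :=
  _root_.isLDL_ldlFactor hr (h.isSymm hr) (h.minorProd_ne_zero hr)

end IsLDL

theorem isLDL_posDef_iff (hr : r.Injective) {S R : Matrix V V ℝ} {d : V → ℝ}
    (h : IsLDL r S R d) : S.PosDef ↔ ∀ v, 0 < d v := by
  have hu : IsUnit R := (isUnit_iff_isUnit_det R).2 (h.isUnit_det hr)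
  rw [← Matrix.IsUnit.posDef_star_left_conjugate_iff hu, star_eq_conjTranspose,
    conjTranspose_eq_transpose_of_trivial, h.eq, posDef_diagonal_iff]

theorem posDef_iff_exists_isLDL (hr : r.Injective) {S : Matrix V V ℝ} :
    S.PosDef ↔ ∃ R d, IsLDL r S R d ∧ ∀ v, 0 < d v := by
  refine ⟨fun hS => ?_, fun ⟨R, d, h, hd⟩ => (isLDL_posDef_iff hr h).2 hd⟩
  have hminor : minorProd r S ≠ 0 := mul_ne_zero hS.det_pos.ne' <|
    Finset.prod_ne_zero_iff.2 fun _ _ => (hS.submatrix Subtype.val_injective).det_pos.ne'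
  have hsymm : S.IsSymm := by
    rw [Matrix.IsSymm, ← conjTranspose_eq_transpose_of_trivial, hS.isHermitian.eq]
  have h := isLDL_ldlFactor hr hsymm hminor
  exact ⟨_, _, h, (isLDL_posDef_iff hr h).1 hS⟩

section Entries

variable {X ι : Type*} {S R : X → Matrix V V K} {d : X → V → K}

theorem EntriesIn.minorProd {B : Subalgebra K (X → K)} (hS : EntriesIn B S) :
    (fun x => minorProd r (S x)) ∈ B :=
  B.mul_mem hS.det (prod_fun_mem fun _ _ => (hS.submatrix Subtype.val Subtype.val).det)

variable {s : ι → X → K} {U : Set X}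

theorem EntriesIn.ldlFactor (hS : EntriesIn (ratAlgebra s U) S)
    (h : ∀ x ∈ U, _root_.minorProd r (S x) ≠ 0) :
    EntriesIn (ratAlgebra s U) fun x => ldlFactor r (S x) := by
  have hminor v : ∀ x ∈ U, (leadingSubmatrix r (S x) v).det ≠ 0 := fun x hx =>
    Finset.prod_ne_zero_iff.1 (right_ne_zero_of_mul (h x hx)) v (Finset.mem_univ v)
  intro u v
  simp only [_root_.ldlFactor]
  split_ifs with huv hlt
  · exact const_fun_mem _ 1
  · have hinv := (hS.submatrix Subtype.val Subtype.val).inv (hminor v)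
    exact neg_mem (sum_fun_mem fun w _ => mul_mem (hinv _ w) (hS w v))
  · exact const_fun_mem _ 0

theorem entriesIn_iff_of_isLDL (hr : r.Injective) (h : ∀ x ∈ U, IsLDL r (S x) (R x) (d x)) :
    EntriesIn (ratAlgebra s U) S ↔
      EntriesIn (ratAlgebra s U) R ∧ ∀ v, (fun x => d x v) ∈ ratAlgebra s U := by
  constructor
  · intro hS
    have hfac := hS.ldlFactor (r := r) fun x hx => (h x hx).minorProd_ne_zero hr
    have unique_ldl x (hx : x ∈ U) := ((h x hx).isLDL_ldlFactor hr).unique hr (h x hx)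
    exact ⟨fun u v => mem_ratAlgebra_congr
        (fun x hx => congrFun (congrFun (unique_ldl x hx).1 u) v) (hfac u v),
      fun v => mem_ratAlgebra_congr
        (fun x hx => congrFun (unique_ldl x hx).2 v) ((hfac.transpose.mul hS).mul hfac v v)⟩
  · rintro ⟨hR, hd⟩ u v
    have hinv := hR.inv fun x hx => ((h x hx).isUnit_det hr).ne_zero
    exact mem_ratAlgebra_congr (fun x hx => congrFun (congrFun ((h x hx).eq_inv hr).symm u) v)
      ((hinv.transpose.mul (.diagonal hd)).mul hinv u v)

end Entries

section Covariance

variable {L O R P : Matrix V V K} {d : V → K}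

theorem IsLDL.covarianceMap (hr : r.Injective) (hL : ∀ u v, r v ≤ r u → L u v = 0)
    (h : IsLDL r O P d) : IsLDL r (covarianceMap (L, O)) ((1 - L) * P) d where
  toIsUnitUpper := (IsUnitUpper.one_sub hL).mul hr h.toIsUnitUpper
  eq := by
    have hu := (IsUnitUpper.one_sub hL).isUnit_det hr
    have hu' : IsUnit (1 - L)ᵀ.det := by rwa [det_transpose]
    rw [← h.eq, _root_.covarianceMap, transpose_mul, transpose_nonsing_inv]
    simp only [Matrix.mul_assoc]
    rw [nonsing_inv_mul_cancel_left _ _ hu, mul_nonsing_inv_cancel_left _ _ hu']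
  ne := h.ne

theorem IsLDL.of_covarianceMap (hr : r.Injective) (hL : ∀ u v, r v ≤ r u → L u v = 0)
    (h : IsLDL r (_root_.covarianceMap (L, O)) R d) : IsLDL r O ((1 - L)⁻¹ * R) d where
  toIsUnitUpper := ((IsUnitUpper.one_sub hL).inv hr).mul hr h.toIsUnitUpper
  eq := by
    rw [← h.eq, _root_.covarianceMap, transpose_mul]
    simp only [Matrix.mul_assoc]
  ne := h.ne

end Covariance

end LDL

namespace MixedGraph

/-! ### Gluing along the mixed components -/

section Gluing

open Matrix

variable {V α K : Type*} (G : MixedGraph V)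

/-- The component of the bidirected part that contains `v`. -/
def component (v : V) : G.ComponentIndex := G.bidirected.connectedComponentMk v

theorem mem_componentVertices_component (v : V) : v ∈ G.componentVertices (G.component v) :=
  Or.inl rfl

theorem component_eq_of_adj {u v : V} (h : G.bidirected.Adj u v) :
    G.component u = G.component v :=
  SimpleGraph.ConnectedComponent.connectedComponentMk_eq_of_adj h

/-- Matrices whose column over `v` is supported on the vertex set of the mixed component of `v`. -/
def ColSupported [Zero K] (M : Matrix V V K) : Prop :=
  ∀ u v, u ∉ G.componentVertices (G.component v) → M u v = 0

/-- Block diagonal matrices with respect to the connected components of the bidirected part. -/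
def IsBlock [Zero K] (M : Matrix V V K) : Prop :=
  ∀ u v, G.component u ≠ G.component v → M u v = 0

open Classical in
/-- The matrix whose columns over `C_j` are those of `M j`. -/
noncomputable def glueCols [Zero K]
    (M : ∀ j, Matrix (G.componentVertices j) (G.componentVertices j) K) : Matrix V V K :=
  fun u v => if h : u ∈ G.componentVertices (G.component v) then
    M (G.component v) ⟨u, h⟩ ⟨v, G.mem_componentVertices_component v⟩ else 0

/-- The vector that agrees with `d j` on `C_j`. -/
def glueVec (d : ∀ j, G.componentVertices j → K) (v : V) : K :=
  d (G.component v) ⟨v, G.mem_componentVertices_component v⟩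

/-- The parameters of `G` assembled from parameters of the mixed components. -/
noncomputable def glue [Zero K] (η : ∀ j, ParamPair (G.componentVertices j) K) : ParamPair V K :=
  (G.glueCols fun j => (η j).1, G.glueCols fun j => (η j).2)

open Classical in
/-- The restriction to `V_j`, with the columns outside `C_j` replaced by those of `diagonal w`. -/
noncomputable def restrictCols [Zero K] (j : G.ComponentIndex) (w : G.componentVertices j → K)
    (M : Matrix V V K) : Matrix (G.componentVertices j) (G.componentVertices j) K :=
  fun u v => if (v : V) ∈ G.componentCore j then M u v else diagonal w u v

open Classical in
/-- The restriction to `V_j`, with the entries outside `C_j` replaced by those of `w`. -/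
noncomputable def restrictVec (j : G.ComponentIndex) (w : G.componentVertices j → K)
    (d : V → K) (v : G.componentVertices j) : K :=
  if (v : V) ∈ G.componentCore j then d v else w v

/-- The parameters of `G_j` obtained from those of `G`, with the variances of the parents outside
`C_j`, which `G` does not determine, chosen to be `w`. -/
noncomputable def restrictParams [Zero K] (j : G.ComponentIndex) (w : G.componentVertices j → K)
    (θ : ParamPair V K) : ParamPair (G.componentVertices j) K :=
  (G.restrictCols j 0 θ.1, G.restrictCols j w θ.2)

variable {G} {j : G.ComponentIndex} {w : G.componentVertices j → K}

theorem restrictVec_of_mem {d : V → K} {v : G.componentVertices j}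
    (hv : (v : V) ∈ G.componentCore j) : G.restrictVec j w d v = d v :=
  if_pos hv

theorem restrictVec_of_notMem {d : V → K} {v : G.componentVertices j}
    (hv : (v : V) ∉ G.componentCore j) : G.restrictVec j w d v = w v :=
  if_neg hv

theorem restrictVec_component {d : V → K} (v : V) (w : G.componentVertices (G.component v) → K) :
    G.restrictVec (G.component v) w d ⟨v, G.mem_componentVertices_component v⟩ = d v :=
  if_pos rfl

theorem glueVec_of_mem {d : ∀ j, G.componentVertices j → K} {v : G.componentVertices j}
    (hv : (v : V) ∈ G.componentCore j) : G.glueVec d v = d j v := by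
  obtain ⟨v, hv'⟩ := v
  obtain rfl : G.component v = j := hv
  rfl

theorem restrictVec_glueVec {d : ∀ j, G.componentVertices j → K}
    (h : ∀ v : G.componentVertices j, (v : V) ∉ G.componentCore j → d j v = w v) :
    G.restrictVec j w (G.glueVec d) = d j := by
  ext v
  by_cases hv : (v : V) ∈ G.componentCore j
  · rw [restrictVec_of_mem hv, glueVec_of_mem hv]
  · rw [restrictVec_of_notMem hv, h v hv]

section Zero

variable [Zero K] {M : Matrix V V K}

theorem restrictCols_apply_of_mem (u : G.componentVertices j) {v : G.componentVertices j}
    (hv : (v : V) ∈ G.componentCore j) : G.restrictCols j w M u v = M u v :=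
  if_pos hv

theorem restrictCols_apply_of_notMem [DecidableEq V] (u : G.componentVertices j)
    {v : G.componentVertices j} (hv : (v : V) ∉ G.componentCore j) :
    G.restrictCols j w M u v = diagonal w u v := by
  rw [restrictCols, if_neg hv]
  congr

theorem restrictCols_component {u v : V} (hu : u ∈ G.componentVertices (G.component v))
    (w : G.componentVertices (G.component v) → K) :
    G.restrictCols (G.component v) w M ⟨u, hu⟩
      ⟨v, G.mem_componentVertices_component v⟩ = M u v :=
  if_pos rfl

theorem glueCols_apply_of_mem {N : ∀ j, Matrix (G.componentVertices j) (G.componentVertices j) K}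
    (u : G.componentVertices j) {v : G.componentVertices j} (hv : (v : V) ∈ G.componentCore j) :
    G.glueCols N u v = N j u v := by
  obtain ⟨v, hv'⟩ := v
  obtain rfl : G.component v = j := hv
  exact dif_pos u.2

theorem glueCols_apply_eq_zero
    {N : ∀ j, Matrix (G.componentVertices j) (G.componentVertices j) K} {u v : V}
    (h : ∀ hu, N (G.component v) ⟨u, hu⟩ ⟨v, G.mem_componentVertices_component v⟩ = 0) :
    G.glueCols N u v = 0 := by
  classical exact dite_eq_right_iff.2 h

theorem IsBlock.colSupported (hM : G.IsBlock M) : G.ColSupported M :=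
  fun u v hu => hM u v fun h => hu (Or.inl h)

theorem IsBlock.transpose (hM : G.IsBlock M) : G.IsBlock Mᵀ :=
  fun u v h => hM v u h.symm

theorem isBlock_diagonal [DecidableEq V] (d : V → K) : G.IsBlock (diagonal d) :=
  fun _ _ h => diagonal_apply_ne _ fun huv => h (congrArg _ huv)

theorem glueCols_restrictCols (hM : G.ColSupported M) (w : ∀ j, G.componentVertices j → K) :
    G.glueCols (fun j => G.restrictCols j (w j) M) = M := by
  ext u v
  by_cases hu : u ∈ G.componentVertices (G.component v)
  · exact (dif_pos hu).trans (restrictCols_component hu _)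
  · exact (dif_neg hu).trans (hM u v hu).symm

theorem eq_iff_forall_restrictCols_eq {N : Matrix V V K} (hM : G.ColSupported M)
    (hN : G.ColSupported N) (w : ∀ j, G.componentVertices j → K) :
    M = N ↔ ∀ j, G.restrictCols j (w j) M = G.restrictCols j (w j) N := by
  refine ⟨fun h j => by rw [h], fun h => ?_⟩
  rw [← glueCols_restrictCols hM w, ← glueCols_restrictCols hN w, funext h]

theorem restrictCols_glueCols [DecidableEq V]
    {N : ∀ j, Matrix (G.componentVertices j) (G.componentVertices j) K}
    (h : ∀ u v : G.componentVertices j, (v : V) ∉ G.componentCore j →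
      N j u v = diagonal w u v) : G.restrictCols j w (G.glueCols N) = N j := by
  ext u v
  by_cases hv : (v : V) ∈ G.componentCore j
  · rw [restrictCols_apply_of_mem _ hv, glueCols_apply_of_mem u hv]
  · rw [restrictCols_apply_of_notMem _ hv, h u v hv]

theorem restrictCols_diagonal [DecidableEq V] (d : V → K) :
    G.restrictCols j w (diagonal d) = diagonal (G.restrictVec j w d) := by
  ext u v
  by_cases hv : (v : V) ∈ G.componentCore j
  · rw [restrictCols_apply_of_mem _ hv]
    obtain rfl | huv := eq_or_ne u v
    · rw [diagonal_apply_eq, diagonal_apply_eq, restrictVec_of_mem hv]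
    · rw [diagonal_apply_ne _ huv, diagonal_apply_ne _ (Subtype.coe_injective.ne huv)]
  · rw [restrictCols_apply_of_notMem _ hv]
    obtain rfl | huv := eq_or_ne u v
    · rw [diagonal_apply_eq, diagonal_apply_eq, restrictVec_of_notMem hv]
    · rw [diagonal_apply_ne _ huv, diagonal_apply_ne _ huv]

theorem restrictCols_apply_eq_zero_of_notMem (hM : G.IsBlock M) {u v : G.componentVertices j}
    (hu : (u : V) ∉ G.componentCore j) (huv : u ≠ v) : G.restrictCols j w M u v = 0 := by
  classical
  by_cases hv : (v : V) ∈ G.componentCore j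
  · rw [restrictCols_apply_of_mem _ hv]
    exact hM _ _ fun h => hu (h.trans hv)
  · rw [restrictCols_apply_of_notMem _ hv, diagonal_apply_ne _ huv]

theorem restrictCols_transpose (hM : G.IsBlock M) :
    G.restrictCols j w Mᵀ = (G.restrictCols j w M)ᵀ := by
  classical
  ext u v
  rw [transpose_apply]
  obtain rfl | huv := eq_or_ne u v
  · by_cases hu : (u : V) ∈ G.componentCore j
    · rw [restrictCols_apply_of_mem _ hu, restrictCols_apply_of_mem _ hu, transpose_apply]
    · rw [restrictCols_apply_of_notMem _ hu, restrictCols_apply_of_notMem _ hu]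
  by_cases hu : (u : V) ∈ G.componentCore j
  · by_cases hv : (v : V) ∈ G.componentCore j
    · rw [restrictCols_apply_of_mem _ hv, restrictCols_apply_of_mem _ hu, transpose_apply]
    · rw [restrictCols_apply_of_notMem _ hv, diagonal_apply_ne _ huv,
        restrictCols_apply_eq_zero_of_notMem hM hv huv.symm]
  · rw [restrictCols_apply_eq_zero_of_notMem hM.transpose hu huv,
      restrictCols_apply_of_notMem _ hu, diagonal_apply_ne _ huv.symm]

end Zero

section Ring

variable [Ring K] {M N : Matrix V V K}

theorem ColSupported.one_sub [DecidableEq V] (hM : G.ColSupported M) :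
    G.ColSupported (1 - M) := fun u v hu => by
  have huv : u ≠ v := fun h => hu (h ▸ G.mem_componentVertices_component v)
  rw [Matrix.sub_apply, hM u v hu, one_apply_ne huv, sub_zero]

theorem restrictCols_one_sub [DecidableEq V] :
    G.restrictCols j 1 (1 - M) = 1 - G.restrictCols j 0 M := by
  ext u v
  by_cases hv : (v : V) ∈ G.componentCore j
  · simp [restrictCols_apply_of_mem _ hv, Matrix.one_apply, Subtype.ext_iff]
  · simp [restrictCols_apply_of_notMem _ hv]

variable [Fintype V]

theorem ColSupported.mul (hM : G.ColSupported M) (hN : G.IsBlock N) :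
    G.ColSupported (M * N) := fun u v hu => by
  rw [mul_apply]
  refine Finset.sum_eq_zero fun x _ => ?_
  by_cases hx : G.component x = G.component v
  · rw [hM u x (hx ▸ hu), zero_mul]
  · rw [hN x v hx, mul_zero]

theorem IsBlock.mul (hM : G.IsBlock M) (hN : G.IsBlock N) : G.IsBlock (M * N) := fun u v huv => by
  rw [mul_apply]
  refine Finset.sum_eq_zero fun x _ => ?_
  by_cases hx : G.component x = G.component v
  · rw [hM u x (hx ▸ huv), zero_mul]
  · rw [hN x v hx, mul_zero]

theorem restrictCols_mul {w' : G.componentVertices j → K} (hN : G.IsBlock N) :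
    G.restrictCols j (w * w') (M * N) = G.restrictCols j w M * G.restrictCols j w' N := by
  classical
  ext u v
  rw [mul_apply]
  by_cases hv : (v : V) ∈ G.componentCore j
  · have hN₀ {x : V} (hx : x ∉ G.componentCore j) : N x v = 0 :=
      hN x v fun h => hx (h.trans hv)
    rw [restrictCols_apply_of_mem _ hv, mul_apply]
    refine (Fintype.sum_of_injective _ Subtype.val_injective _ _ (fun x hx => ?_)
      fun x => ?_).symm
    · rw [hN₀ fun hxj => hx ⟨⟨x, Or.inl hxj⟩, rfl⟩, mul_zero]
    · rw [restrictCols_apply_of_mem _ hv]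
      by_cases hx : (x : V) ∈ G.componentCore j
      · rw [restrictCols_apply_of_mem _ hx]
      · rw [hN₀ hx, mul_zero, mul_zero]
  · simp only [restrictCols_apply_of_notMem _ hv]
    rw [← mul_apply, mul_diagonal, restrictCols_apply_of_notMem _ hv]
    obtain rfl | huv := eq_or_ne u v
    · simp only [diagonal_apply_eq, Pi.mul_apply]
    · simp only [diagonal_apply_ne _ huv, zero_mul]

end Ring

section LDL

variable [LinearOrder α] {r : V → α} [Field K] {M P Ω : Matrix V V K} {d : V → K}
  {w : ∀ j, G.componentVertices j → K}

theorem isUnitUpper_iff_forall_restrictCols (hP : G.ColSupported P) :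
    IsUnitUpper r P ↔
      ∀ j, IsUnitUpper (fun u : G.componentVertices j => r u) (G.restrictCols j 1 P) := by
  classical
  refine ⟨fun h j => ⟨fun u v huv => ?_, fun v => ?_⟩, fun h => ⟨fun u v huv => ?_, fun v => ?_⟩⟩
  · by_cases hv : (v : V) ∈ G.componentCore j
    · rw [restrictCols_apply_of_mem _ hv, h.tri huv]
    · rw [restrictCols_apply_of_notMem _ hv, diagonal_apply_ne]
      rintro rfl
      exact lt_irrefl _ huv
  · by_cases hv : (v : V) ∈ G.componentCore j
    · rw [restrictCols_apply_of_mem _ hv, h.diag]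
    · rw [restrictCols_apply_of_notMem _ hv, diagonal_apply_eq, Pi.one_apply]
  · by_cases hu : u ∈ G.componentVertices (G.component v)
    · have := (h (G.component v)).tri (i := ⟨u, hu⟩)
        (j := ⟨v, G.mem_componentVertices_component v⟩) huv
      rwa [restrictCols_component] at this
    · exact hP u v hu
  · have := (h (G.component v)).diag ⟨v, G.mem_componentVertices_component v⟩
    rwa [restrictCols_component] at this

variable [Fintype V] [DecidableEq V]

theorem isLDL_iff_forall_restrictCols (hΩ : G.IsBlock Ω) (hP : G.IsBlock P)
    (hw : ∀ j, ∀ u : G.componentVertices j, (u : V) ∉ G.componentCore j → w j u ≠ 0) :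
    IsLDL r Ω P d ↔ ∀ j, IsLDL (fun u : G.componentVertices j => r u)
      (G.restrictCols j (w j) Ω) (G.restrictCols j 1 P) (G.restrictVec j (w j) d) := by
  have eq_iff : Pᵀ * Ω * P = diagonal d ↔
      ∀ j, (G.restrictCols j 1 P)ᵀ * G.restrictCols j (w j) Ω * G.restrictCols j 1 P =
        diagonal (G.restrictVec j (w j) d) := by
    refine (eq_iff_forall_restrictCols_eq ((hP.transpose.mul hΩ).mul hP).colSupported
      (isBlock_diagonal d).colSupported fun j => 1 * w j * 1).trans (forall_congr' fun j => ?_)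
    rw [restrictCols_mul hP, restrictCols_mul hΩ, restrictCols_transpose hP,
      restrictCols_diagonal, one_mul, mul_one]
  have ne_iff : (∀ v, d v ≠ 0) ↔ ∀ j v, G.restrictVec j (w j) d v ≠ 0 := by
    refine ⟨fun h j v => ?_, fun h v => ?_⟩
    · by_cases hv : (v : V) ∈ G.componentCore j
      · rw [restrictVec_of_mem hv]
        exact h v
      · rw [restrictVec_of_notMem hv]
        exact hw j v hv
    · have := h _ ⟨v, G.mem_componentVertices_component v⟩
      rwa [restrictVec_component] at this
  rw [isLDL_iff, isUnitUpper_iff_forall_restrictCols hP.colSupported, eq_iff, ne_iff]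
  simp only [isLDL_iff, forall_and]

end LDL

end Gluing

section Rank

variable {V α : Type*} {G : MixedGraph V} [LinearOrder α] {r : V → α}

/-- An injective ranking of the vertices in which every directed edge ascends. -/
structure IsTopologicalRank (G : MixedGraph V) (r : V → α) : Prop where
  injective : r.Injective
  lt_of_directed : ∀ ⦃u v⦄, G.directed u v → r u < r v

theorem IsTopologicalRank.mixedComponent (hr : G.IsTopologicalRank r) (j : G.ComponentIndex) :
    (G.mixedComponent j).IsTopologicalRank fun u => r u where
  injective := hr.injective.comp Subtype.val_injective
  lt_of_directed _ _ h := hr.lt_of_directed h.1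

theorem Acyclic.exists_isTopologicalRank.{u} {V : Type u} {G : MixedGraph V} (hG : G.Acyclic) :
    ∃ (α : Type u) (_ : LinearOrder α) (r : V → α), G.IsTopologicalRank r := by
  have : IsStrictOrder V (Relation.TransGen G.directed) :=
    { irrefl := hG, trans := fun _ _ _ => Relation.TransGen.trans }
  let _ : PartialOrder V := partialOrderOfSO (Relation.TransGen G.directed)
  have hinj : Function.Injective (toLinearExtension : V → LinearExtension V) := fun _ _ h => h
  refine ⟨LinearExtension V, inferInstance, toLinearExtension, hinj, fun u v huv => ?_⟩
  have hlt : u < v := Relation.TransGen.single huv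
  exact (toLinearExtension.monotone hlt.le).lt_of_ne (hinj.ne hlt.ne)

end Rank

section Supports

open Matrix

variable {V α K : Type*} [Zero K] {G : MixedGraph V} {θ : ParamPair V K} {j : G.ComponentIndex}
  {η : ParamPair (G.componentVertices j) K} {u v : G.componentVertices j}

/-- The graph contains every edge on which an off-diagonal entry of `(Λ, Ω)` is nonzero. -/
structure Supports (G : MixedGraph V) (θ : ParamPair V K) : Prop where
  fst : ∀ ⦃v w⦄, ¬ G.directed v w → θ.1 v w = 0
  snd : ∀ ⦃v w⦄, v ≠ w → ¬ G.bidirected.Adj v w → θ.2 v w = 0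

namespace Supports

theorem fst_eq_zero_of_le [LinearOrder α] {r : V → α} (hθ : G.Supports θ)
    (hr : G.IsTopologicalRank r) (u v : V) (huv : r v ≤ r u) : θ.1 u v = 0 :=
  hθ.fst fun h => (hr.lt_of_directed h).not_ge huv

theorem colSupported (hθ : G.Supports θ) : G.ColSupported θ.1 :=
  fun _ v hu => hθ.fst fun h => hu (Or.inr ⟨v, rfl, h⟩)

theorem isBlock (hθ : G.Supports θ) : G.IsBlock θ.2 :=
  fun _ _ h => hθ.snd (fun huv => h (congrArg _ huv)) fun hadj => h (G.component_eq_of_adj hadj)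

theorem fst_eq_zero_of_notMem (hη : (G.mixedComponent j).Supports η)
    (hv : (v : V) ∉ G.componentCore j) : η.1 u v = 0 :=
  hη.fst fun h => hv h.2

theorem snd_eq_zero_of_notMem (hη : (G.mixedComponent j).Supports η) (huv : u ≠ v)
    (hcore : ¬ ((u : V) ∈ G.componentCore j ∧ (v : V) ∈ G.componentCore j)) : η.2 u v = 0 :=
  hη.snd huv fun h => hcore h.2

theorem glue {η : ∀ j, ParamPair (G.componentVertices j) K}
    (hη : ∀ j, (G.mixedComponent j).Supports (η j)) : G.Supports (G.glue η) := by
  refine ⟨fun u v huv => glueCols_apply_eq_zero (N := fun j => (η j).1) fun _ =>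
    (hη _).fst fun h => huv h.1, fun u v huv hadj => glueCols_apply_eq_zero
      (N := fun j => (η j).2) fun _ => (hη _).snd (fun h => ?_) fun h => hadj h.1⟩
  exact huv (congrArg Subtype.val h)

theorem restrictParams (hθ : G.Supports θ) (j : G.ComponentIndex)
    (w : G.componentVertices j → K) : (G.mixedComponent j).Supports (G.restrictParams j w θ) := by
  classical
  refine ⟨fun u v huv => ?_, fun u v huv hadj => ?_⟩
  · by_cases hv : (v : V) ∈ G.componentCore j
    · exact (restrictCols_apply_of_mem u hv).trans (hθ.fst fun h => huv ⟨h, hv⟩)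
    · exact (restrictCols_apply_of_notMem u hv).trans (by rw [diagonal_zero', Matrix.zero_apply])
  · by_cases hu : (u : V) ∈ G.componentCore j
    · by_cases hv : (v : V) ∈ G.componentCore j
      · exact (restrictCols_apply_of_mem u hv).trans
          (hθ.snd (Subtype.coe_injective.ne huv) fun h => hadj ⟨h, hu, hv⟩)
      · exact (restrictCols_apply_of_notMem u hv).trans (diagonal_apply_ne _ huv)
    · exact restrictCols_apply_eq_zero_of_notMem hθ.isBlock hu huv

theorem glue_restrictParams (hθ : G.Supports θ) (w : ∀ j, G.componentVertices j → K) :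
    G.glue (fun j => G.restrictParams j (w j) θ) = θ :=
  Prod.ext (glueCols_restrictCols hθ.colSupported 0)
    (glueCols_restrictCols hθ.isBlock.colSupported w)

theorem restrictCols_glue_fst {η : ∀ j, ParamPair (G.componentVertices j) K}
    (hη : (G.mixedComponent j).Supports (η j)) : G.restrictCols j 0 (G.glue η).1 = (η j).1 := by
  classical
  refine restrictCols_glueCols (N := fun j => (η j).1) fun u v hv => ?_
  rw [hη.fst_eq_zero_of_notMem hv, diagonal_zero', Matrix.zero_apply]

theorem restrictParams_glue {η : ∀ j, ParamPair (G.componentVertices j) K}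
    {w : G.componentVertices j → K} (hη : (G.mixedComponent j).Supports (η j))
    (hw : ∀ v : G.componentVertices j, (v : V) ∉ G.componentCore j → (η j).2 v v = w v) :
    G.restrictParams j w (G.glue η) = η j := by
  classical
  refine Prod.ext hη.restrictCols_glue_fst
    (restrictCols_glueCols (N := fun j => (η j).2) fun u v hv => ?_)
  obtain rfl | huv := eq_or_ne u v
  · rw [hw u hv, diagonal_apply_eq]
  · rw [hη.snd_eq_zero_of_notMem huv fun h => hv h.2, diagonal_apply_ne _ huv]

end Supports

end Supports

section Component

open Matrix

variable {V α K : Type*} [Finite V] [DecidableEq V] [LinearOrder α] [Field K]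
  {G : MixedGraph V} {r : V → α} {j : G.ComponentIndex} {η : ParamPair (G.componentVertices j) K}
  {P : Matrix (G.componentVertices j) (G.componentVertices j) K} {d : G.componentVertices j → K}

theorem Supports.covarianceMap_apply_self (hη : (G.mixedComponent j).Supports η)
    (hr : G.IsTopologicalRank r) {p : G.componentVertices j}
    (hp : (p : V) ∉ G.componentCore j) : covarianceMap η p p = η.2 p p := by
  have hinv := nonsing_inv_mul (1 - η.1) <|
    (IsUnitUpper.one_sub (hη.fst_eq_zero_of_le (hr.mixedComponent j))).isUnit_det
      (hr.mixedComponent j).injective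
  have hcol u : (1 - η.1)⁻¹ u p = (1 : Matrix _ _ K) u p := by
    rw [← congrFun (congrFun hinv u) p, mul_apply, Fintype.sum_eq_single p fun x hx => ?_]
    · rw [Matrix.sub_apply, one_apply_eq, hη.fst_eq_zero_of_notMem hp, sub_zero, mul_one]
    · rw [Matrix.sub_apply, one_apply_ne hx, hη.fst_eq_zero_of_notMem hp, sub_zero, mul_zero]
  simp only [covarianceMap, mul_apply, transpose_apply, hcol, one_apply, ite_mul, one_mul, zero_mul,
    mul_ite, mul_one, mul_zero, Finset.sum_ite_eq', Finset.mem_univ, if_true]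

variable [NeZero (2 : K)]

theorem Supports.ldlFactor_apply_eq_zero (hη : (G.mixedComponent j).Supports η)
    (hr : G.IsTopologicalRank r) (h : IsLDL (fun u : G.componentVertices j => r u) η.2 P d)
    {u v : G.componentVertices j} (huv : u ≠ v)
    (hcore : ¬ ((u : V) ∈ G.componentCore j ∧ (v : V) ∈ G.componentCore j)) : P u v = 0 := by
  classical
  refine h.apply_eq_zero_of_block (hr.mixedComponent j).injective
    (c := fun x => if (x : V) ∈ G.componentCore j then none else some x) (fun x y hxy => ?_) ?_
  · refine hη.snd_eq_zero_of_notMem (fun h => hxy (by rw [h])) fun h => hxy ?_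
    rw [if_pos h.1, if_pos h.2]
  · grind

theorem Supports.ldlPivot_eq_apply_self (hη : (G.mixedComponent j).Supports η)
    (hr : G.IsTopologicalRank r) (h : IsLDL (fun u : G.componentVertices j => r u) η.2 P d)
    {p : G.componentVertices j} (hp : (p : V) ∉ G.componentCore j) : d p = η.2 p p :=
  h.pivot_eq_apply_self (hr.mixedComponent j).injective fun _ hv =>
    hη.snd_eq_zero_of_notMem hv fun h => hp h.2

end Component

section LDL

open Matrix

variable {V α K : Type*} [Fintype V] [DecidableEq V] [LinearOrder α] [Field K]
  {G : MixedGraph V} {r : V → α}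

theorem exists_isLDL_covarianceMap_iff (hr : G.IsTopologicalRank r) {θ : ParamPair V K}
    (hθ : G.Supports θ) {p : (V → K) → Prop} :
    (∃ R d, IsLDL r (covarianceMap θ) R d ∧ p d) ↔ ∃ R d, IsLDL r θ.2 R d ∧ p d := by
  have hL := hθ.fst_eq_zero_of_le hr
  exact ⟨fun ⟨R, d, h, hd⟩ => ⟨_, d, .of_covarianceMap hr.injective hL h, hd⟩,
    fun ⟨R, d, h, hd⟩ => ⟨_, d, .covarianceMap hr.injective hL h, hd⟩⟩

variable [NeZero (2 : K)] {j : G.ComponentIndex}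

variable {η : ∀ j, ParamPair (G.componentVertices j) K}
  {R P : ∀ j, Matrix (G.componentVertices j) (G.componentVertices j) K}
  {d : ∀ j, G.componentVertices j → K}

theorem isLDL_glue_snd (hr : G.IsTopologicalRank r)
    (hη : ∀ j, (G.mixedComponent j).Supports (η j))
    (h : ∀ j, IsLDL (fun u : G.componentVertices j => r u) (η j).2 (P j) (d j)) :
    G.IsBlock (G.glueCols P) ∧ (∀ j, G.restrictCols j 1 (G.glueCols P) = P j) ∧
      IsLDL r (G.glue η).2 (G.glueCols P) (G.glueVec d) := by
  have hblock : G.IsBlock (G.glueCols P) := fun u v huv => glueCols_apply_eq_zero fun _ =>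
    (hη _).ldlFactor_apply_eq_zero hr (h _) (fun h => huv (congrArg _ (congrArg Subtype.val h)))
      fun h => huv h.1
  have hcols j : G.restrictCols j 1 (G.glueCols P) = P j := restrictCols_glueCols fun u v hv => by
    obtain rfl | huv := eq_or_ne u v
    · rw [(h j).diag, diagonal_apply_eq, Pi.one_apply]
    · rw [(hη j).ldlFactor_apply_eq_zero hr (h j) huv fun h => hv h.2, diagonal_apply_ne _ huv]
  refine ⟨hblock, hcols, (isLDL_iff_forall_restrictCols (w := d) (Supports.glue hη).isBlock hblock
    fun j u _ => (h j).ne u).2 fun j => ?_⟩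
  have hsnd : G.restrictCols j (d j) (G.glue η).2 = (η j).2 :=
    congrArg Prod.snd ((hη j).restrictParams_glue fun v hv =>
      ((hη j).ldlPivot_eq_apply_self hr (h j) hv).symm)
  rw [hcols, hsnd, restrictVec_glueVec fun _ _ => rfl]
  exact h j

theorem isLDL_covarianceMap_glue (hr : G.IsTopologicalRank r)
    (hη : ∀ j, (G.mixedComponent j).Supports (η j))
    (h : ∀ j, IsLDL (fun u : G.componentVertices j => r u) (covarianceMap (η j)) (R j) (d j)) :
    IsLDL r (covarianceMap (G.glue η)) (G.glueCols R) (G.glueVec d) := by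
  have hL j := (hη j).fst_eq_zero_of_le (hr.mixedComponent j)
  have hglue := Supports.glue hη
  obtain ⟨hblock, hcols, hP⟩ := isLDL_glue_snd hr hη fun j =>
    .of_covarianceMap (hr.mixedComponent j).injective (hL j) (h j)
  convert hP.covarianceMap hr.injective (hglue.fst_eq_zero_of_le hr) using 1
  rw [← glueCols_restrictCols (hglue.colSupported.one_sub.mul hblock) fun _ => 1 * 1]
  congr! 2 with j
  rw [restrictCols_mul hblock, hcols, restrictCols_one_sub, (hη j).restrictCols_glue_fst,
    mul_nonsing_inv_cancel_left]
  exact (IsUnitUpper.one_sub (hL j)).isUnit_det (hr.mixedComponent j).injective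

theorem isLDL_covarianceMap_restrictParams (hr : G.IsTopologicalRank r) {θ : ParamPair V K}
    (hθ : G.Supports θ) {w : ∀ j, G.componentVertices j → K}
    (hw : ∀ j, ∀ u : G.componentVertices j, (u : V) ∉ G.componentCore j → w j u ≠ 0)
    {R : Matrix V V K} {d : V → K} (h : IsLDL r (covarianceMap θ) R d) (j : G.ComponentIndex) :
    IsLDL (fun u : G.componentVertices j => r u) (covarianceMap (G.restrictParams j (w j) θ))
      (G.restrictCols j 1 R) (G.restrictVec j (w j) d) := by
  have hL := hθ.fst_eq_zero_of_le hr
  have hP := IsLDL.of_covarianceMap hr.injective hL h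
  have hblock : G.IsBlock ((1 - θ.1)⁻¹ * R) := fun _ _ =>
    hP.apply_eq_zero_of_block hr.injective hθ.isBlock
  have hR : (1 - G.restrictCols j 0 θ.1) * G.restrictCols j 1 ((1 - θ.1)⁻¹ * R) =
      G.restrictCols j 1 R := by
    rw [← restrictCols_one_sub, ← restrictCols_mul hblock, mul_one,
      mul_nonsing_inv_cancel_left _ _ ((IsUnitUpper.one_sub hL).isUnit_det hr.injective)]
  rw [← hR]
  exact ((isLDL_iff_forall_restrictCols hθ.isBlock hblock hw).1 hP j).covarianceMap
    (hr.mixedComponent j).injective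
    ((hθ.restrictParams j (w j)).fst_eq_zero_of_le (hr.mixedComponent j))

end LDL

section Entries

variable {V K X : Type*} [CommRing K] {G : MixedGraph V} {B : Subalgebra K (X → K)}
  {j : G.ComponentIndex} {w : X → G.componentVertices j → K}

theorem entriesIn_glueCols
    {M : ∀ j, X → Matrix (G.componentVertices j) (G.componentVertices j) K}
    (hM : ∀ j, EntriesIn B (M j)) : EntriesIn B fun x => G.glueCols fun j => M j x := by
  intro u v
  by_cases hu : u ∈ G.componentVertices (G.component v)
  · exact (funext fun x => (dif_pos hu).symm) ▸ hM _ ⟨u, hu⟩ _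
  · exact (funext fun x => (dif_neg hu).symm) ▸ const_fun_mem B 0

theorem glueVec_mem {d : ∀ j, X → G.componentVertices j → K}
    (hd : ∀ j u, (fun x => d j x u) ∈ B) (v : V) : (fun x => G.glueVec (fun j => d j x) v) ∈ B :=
  hd _ _

theorem restrictVec_mem {d : X → V → K} (hd : ∀ v, (fun x => d x v) ∈ B)
    (hw : ∀ u, (fun x => w x u) ∈ B) (v : G.componentVertices j) :
    (fun x => G.restrictVec j (w x) (d x) v) ∈ B := by
  by_cases hv : (v : V) ∈ G.componentCore j
  · simpa only [restrictVec_of_mem hv] using hd v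
  · simpa only [restrictVec_of_notMem hv] using hw v

theorem entriesIn_restrictCols {M : X → Matrix V V K} (hM : EntriesIn B M)
    (hw : ∀ u, (fun x => w x u) ∈ B) : EntriesIn B fun x => G.restrictCols j (w x) (M x) := by
  classical
  intro u v
  by_cases hv : (v : V) ∈ G.componentCore j
  · simpa only [restrictCols_apply_of_mem u hv] using hM u v
  · simpa only [restrictCols_apply_of_notMem u hv] using EntriesIn.diagonal hw u v

end Entries

end MixedGraph

namespace ParamPair

variable {V K X : Type*}

/-- The entries of `(Λ, Ω)` as coordinate functions. -/
def coord (i : (V × V) ⊕ (V × V)) (θ : ParamPair V K) : K := θ.coords i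

/-- The entries of the covariance matrix as functions of `(Λ, Ω)`. -/
noncomputable def covarianceCoord [Fintype V] [DecidableEq V] [CommRing K] (e : V × V)
    (θ : ParamPair V K) : K :=
  covarianceMap θ e.1 e.2

theorem forall_coord_comp_mem_iff [CommRing K] {B : Subalgebra K (X → K)} {t : X → ParamPair V K} :
    (∀ i, coord i ∘ t ∈ B) ↔ EntriesIn B (fun x => (t x).1) ∧ EntriesIn B fun x => (t x).2 := by
  rw [Sum.forall, Prod.forall, Prod.forall]
  rfl

theorem entriesIn_covarianceMap_apply [Field K] {ι : Type*} {V : ι → Type*}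
    [∀ i, Fintype (V i)] [∀ i, DecidableEq (V i)] (U : Set (∀ i, ParamPair (V i) K)) (i : ι) :
    EntriesIn (ratAlgebra (piCoords fun _ => covarianceCoord) U) fun η => covarianceMap (η i) :=
  fun u v => coord_mem_ratAlgebra (s := piCoords fun k => covarianceCoord (V := V k)) ⟨i, u, v⟩

end ParamPair

namespace MixedGraph

open ParamPair

section EntriesGlue

variable {V K X : Type*} [CommRing K] {G : MixedGraph V} {B : Subalgebra K (X → K)}

theorem coord_glue_comp_mem {t : X → ∀ j, ParamPair (G.componentVertices j) K}
    (ht : ∀ c, piCoords (fun _ => coord) c ∘ t ∈ B) (i : (V × V) ⊕ (V × V)) :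
    coord i ∘ (fun x => G.glue (t x)) ∈ B := by
  have hentries j := (forall_coord_comp_mem_iff (t := fun x => t x j)).1 fun i => ht ⟨j, i⟩
  exact forall_coord_comp_mem_iff.2
    ⟨entriesIn_glueCols fun j => (hentries j).1, entriesIn_glueCols fun j => (hentries j).2⟩ i

theorem coord_restrictParams_comp_mem {t : X → ParamPair V K} (ht : ∀ i, coord i ∘ t ∈ B)
    {j : G.ComponentIndex} {w : X → G.componentVertices j → K} (hw : ∀ u, (fun x => w x u) ∈ B)
    (i : (G.componentVertices j × G.componentVertices j) ⊕
      (G.componentVertices j × G.componentVertices j)) :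
    coord i ∘ (fun x => G.restrictParams j (w x) (t x)) ∈ B := by
  have hentries := forall_coord_comp_mem_iff.1 ht
  exact forall_coord_comp_mem_iff.2
    ⟨entriesIn_restrictCols hentries.1 fun _ => const_fun_mem B 0,
      entriesIn_restrictCols hentries.2 hw⟩ i

end EntriesGlue

/-! ### Parameters with prescribed pivots -/

section PivotParams

variable {V α K : Type*} [Fintype V] [DecidableEq V] [LinearOrder α] [Field K]

/-- The parameters whose covariance matrix has an `LDL` decomposition with pivots in `P`. For
`P = Set.Ioi 0` these are the real parameters, and for `P = {0}ᶜ` the generic complex ones. -/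
def pivotParams (G : MixedGraph V) (r : V → α) (P : Set K) : Set (ParamPair V K) :=
  {θ | G.Supports θ ∧ ∃ R d, IsLDL r (covarianceMap θ) R d ∧ ∀ v, d v ∈ P}

/-- The families of parameters of the mixed components with pivots in `P`. -/
abbrev componentParams (G : MixedGraph V) (r : V → α) (P : Set K) :
    Set (∀ j, ParamPair (G.componentVertices j) K) :=
  Set.pi Set.univ fun j => (G.mixedComponent j).pivotParams (fun u => r u) P

variable {G : MixedGraph V} {r : V → α} {P : Set K} {θ θ' : ParamPair V K}
  {η η' : ∀ j, ParamPair (G.componentVertices j) K} {w : ∀ j, G.componentVertices j → K}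

theorem isLDL_ldlFactor_of_mem_pivotParams (hr : G.IsTopologicalRank r)
    (hθ : θ ∈ G.pivotParams r P) :
    IsLDL r (covarianceMap θ) (ldlFactor r (covarianceMap θ)) (ldlPivots r (covarianceMap θ)) :=
  have ⟨_, _, _, h, _⟩ := hθ
  h.isLDL_ldlFactor hr.injective

theorem zero_one_mem_pivotParams (hP : 1 ∈ P) : ((0, 1) : ParamPair V K) ∈ G.pivotParams r P := by
  refine ⟨⟨fun _ _ _ => rfl, fun _ _ h _ => Matrix.one_apply_ne h⟩, 1, 1,
    ⟨⟨fun u v huv => Matrix.one_apply_ne ?_, fun v => Matrix.one_apply_eq v⟩, ?_,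
      fun _ => one_ne_zero⟩, fun _ => hP⟩
  · rintro rfl
    exact lt_irrefl _ huv
  · simp [covarianceMap]

theorem componentParams_nonempty (hP : 1 ∈ P) : (G.componentParams r P).Nonempty :=
  ⟨fun _ => (0, 1), fun _ _ => zero_one_mem_pivotParams hP⟩

theorem restrictParams_glue_of_mem (hr : G.IsTopologicalRank r)
    (hη : η ∈ G.componentParams r P) (j : G.ComponentIndex) :
    G.restrictParams j (fun u => covarianceMap (η j) u u) (G.glue η) = η j :=
  (hη j trivial).1.restrictParams_glue fun _ hv =>
    ((hη j trivial).1.covarianceMap_apply_self hr hv).symm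

theorem eq_of_glue_eq (hr : G.IsTopologicalRank r) (hη : η ∈ G.componentParams r P)
    (hη' : η' ∈ G.componentParams r P) (h : G.glue η = G.glue η')
    (hcov : ∀ j, covarianceMap (η j) = covarianceMap (η' j)) : η = η' := funext fun j => by
  rw [← restrictParams_glue_of_mem hr hη j, ← restrictParams_glue_of_mem hr hη' j, h, hcov j]

variable [NeZero (2 : K)]

theorem restrictParams_mem_componentParams (hr : G.IsTopologicalRank r) (hP : 0 ∉ P)
    (hθ : θ ∈ G.pivotParams r P) (hw : ∀ j u, w j u ∈ P) :
    (fun j => G.restrictParams j (w j) θ) ∈ G.componentParams r P := fun j _ => by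
  obtain ⟨hsupp, R, d, h, hd⟩ := hθ
  refine ⟨hsupp.restrictParams j _, _, _, isLDL_covarianceMap_restrictParams hr hsupp
    (fun j u _ => ne_of_mem_of_not_mem (hw j u) hP) h j, fun v => ?_⟩
  by_cases hv : (v : V) ∈ G.componentCore j
  · rw [restrictVec_of_mem hv]
    exact hd v
  · rw [restrictVec_of_notMem hv]
    exact hw j v

theorem covarianceMap_restrictParams_congr (hr : G.IsTopologicalRank r) (hP : 0 ∉ P)
    (hθ : θ ∈ G.pivotParams r P) (hθ' : θ' ∈ G.pivotParams r P) (hw : ∀ j u, w j u ∈ P)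
    (h : covarianceMap θ = covarianceMap θ') (j : G.ComponentIndex) :
    covarianceMap (G.restrictParams j (w j) θ) = covarianceMap (G.restrictParams j (w j) θ') := by
  have hw₀ : ∀ j, ∀ u : G.componentVertices j, (u : V) ∉ G.componentCore j → w j u ≠ 0 :=
    fun j u _ => ne_of_mem_of_not_mem (hw j u) hP
  obtain ⟨hsupp, R, d, hR, -⟩ := hθ
  exact (isLDL_covarianceMap_restrictParams hr hsupp hw₀ hR j).eq_of_eq
    (hr.mixedComponent j).injective
    (isLDL_covarianceMap_restrictParams hr hθ'.1 hw₀ (h ▸ hR) j)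

theorem glue_mem_pivotParams (hr : G.IsTopologicalRank r)
    (hη : η ∈ G.componentParams r P) : G.glue η ∈ G.pivotParams r P := by
  choose hsupp R d h hd using fun j => hη j trivial
  exact ⟨Supports.glue hsupp, _, _, isLDL_covarianceMap_glue hr hsupp h, fun v => hd _ _⟩

theorem covarianceMap_glue_congr (hr : G.IsTopologicalRank r)
    (hη : η ∈ G.componentParams r P) (hη' : η' ∈ G.componentParams r P)
    (h : ∀ j, covarianceMap (η j) = covarianceMap (η' j)) :
    covarianceMap (G.glue η) = covarianceMap (G.glue η') := by
  choose hsupp R d hR _ using fun j => hη j trivial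
  exact (isLDL_covarianceMap_glue hr hsupp hR).eq_of_eq hr.injective
    (isLDL_covarianceMap_glue hr (fun j => (hη' j trivial).1) fun j => h j ▸ hR j)

theorem exists_restrictParams_glue_eq (hr : G.IsTopologicalRank r)
    (hη : η ∈ G.componentParams r P) :
    ∃ w : ∀ j, G.componentVertices j → K, (∀ j u, w j u ∈ P) ∧
      (fun j => G.restrictParams j (w j) (G.glue η)) = η := by
  choose hsupp hLDL using fun j => hη j trivial
  choose R d h hd using fun j =>
    (exists_isLDL_covarianceMap_iff (hr.mixedComponent j) (hsupp j)).1 (hLDL j)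
  exact ⟨d, hd, funext fun j => (hsupp j).restrictParams_glue fun _ hv =>
    ((hsupp j).ldlPivot_eq_apply_self hr (h j) hv).symm⟩

theorem covarianceFiber_glue (hr : G.IsTopologicalRank r) (hP : 0 ∉ P)
    (hη : η ∈ G.componentParams r P) :
    covarianceFiber (G.pivotParams r P) (G.glue η) =
      G.glue '' Set.pi Set.univ fun j =>
        covarianceFiber ((G.mixedComponent j).pivotParams (fun u => r u) P) (η j) := by
  ext θ
  constructor
  · rintro ⟨hθ, hcov⟩
    obtain ⟨w, hw, hwη⟩ := exists_restrictParams_glue_eq hr hη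
    refine ⟨_, fun j _ => ⟨restrictParams_mem_componentParams hr hP hθ hw j trivial, ?_⟩,
      hθ.1.glue_restrictParams w⟩
    rw [covarianceMap_restrictParams_congr hr hP hθ (glue_mem_pivotParams hr hη) hw hcov]
    exact congrArg covarianceMap (congrFun hwη j)
  · rintro ⟨η', hη', rfl⟩
    have hmem : η' ∈ G.componentParams r P := fun j _ => (hη' j trivial).1
    exact ⟨glue_mem_pivotParams hr hmem,
      covarianceMap_glue_congr hr hmem hη fun j => (hη' j trivial).2⟩

theorem encard_covarianceFiber_glue (hr : G.IsTopologicalRank r) (hP : 0 ∉ P)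
    (hη : η ∈ G.componentParams r P) :
    (covarianceFiber (G.pivotParams r P) (G.glue η)).encard = ∏ j,
      (covarianceFiber ((G.mixedComponent j).pivotParams (fun u => r u) P) (η j)).encard := by
  rw [covarianceFiber_glue hr hP hη, Set.InjOn.encard_image, Set.encard_pi_eq_prod_encard]
  intro η₁ h₁ η₂ h₂ h
  exact eq_of_glue_eq hr (fun j _ => (h₁ j trivial).1) (fun j _ => (h₂ j trivial).1) h
    fun j => (h₁ j trivial).2.trans (h₂ j trivial).2.symm

end PivotParams

section Transfer

variable {V α K : Type*} [Fintype V] [DecidableEq V] [LinearOrder α] [Field K] [NeZero (2 : K)]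
  {G : MixedGraph V} {r : V → α} {P : Set K}

-- The map `glue` is not injective on `componentParams`, which is why a generic property is pulled
-- back along `glue` in one direction and along its sections `restrictParams` in the other.
theorem exists_mem_basicOpens_pivotParams_iff (hr : G.IsTopologicalRank r) (hP₀ : 0 ∉ P)
    (hP₁ : 1 ∈ P) {Q : Set (ParamPair V K) → Prop}
    {Q' : Set (∀ j, ParamPair (G.componentVertices j) K) → Prop}
    (hQ : ∀ U ⊆ G.pivotParams r P, Q U → Q' {η ∈ G.componentParams r P | G.glue η ∈ U})
    (hQ' : ∀ w : ∀ j, G.componentVertices j → K, (∀ j u, w j u ∈ P) →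
      ∀ U ⊆ G.componentParams r P, Q' U →
        Q {θ ∈ G.pivotParams r P | (fun j => G.restrictParams j (w j) θ) ∈ U}) :
    (∃ U ∈ basicOpens (polyAlgebra coord) (G.pivotParams r P), Q U) ↔
      ∃ U ∈ basicOpens (polyAlgebra (piCoords fun _ => coord)) (G.componentParams r P), Q' U := by
  constructor
  · rintro ⟨U, hU, hQU⟩
    have hUT := subset_of_mem_basicOpens hU
    refine ⟨_, preimage_mem_basicOpens (fun η hη => glue_mem_pivotParams hr hη)
      (coord_glue_comp_mem (t := id) fun c => coord_mem_polyAlgebra _ c) hU ?_, hQ U hUT hQU⟩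
    obtain ⟨θ, hθ⟩ := hU.1
    refine ⟨_, restrictParams_mem_componentParams hr hP₀ (hUT hθ) fun _ _ => hP₁, ?_⟩
    rwa [(hUT hθ).1.glue_restrictParams]
  · rintro ⟨U, hU, hQU⟩
    have hUT := subset_of_mem_basicOpens hU
    obtain ⟨η, hη⟩ := hU.1
    obtain ⟨w, hw, hwη⟩ := exists_restrictParams_glue_eq hr (hUT hη)
    refine ⟨_, preimage_mem_basicOpens
      (fun θ hθ => restrictParams_mem_componentParams hr hP₀ hθ hw)
      (fun c => coord_restrictParams_comp_mem (t := id) (fun i => coord_mem_polyAlgebra _ i)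
        (fun u => const_fun_mem _ (w c.1 u)) c.2) hU ?_, hQ' w hw U hUT hQU⟩
    exact ⟨_, glue_mem_pivotParams hr (hUT hη), hwη.symm ▸ hη⟩

theorem exists_encard_covarianceFiber_eq_iff (hr : G.IsTopologicalRank r) (hP₀ : 0 ∉ P)
    (hP₁ : 1 ∈ P) {h : ℕ∞} :
    (∃ U ∈ basicOpens (polyAlgebra coord) (G.pivotParams r P),
      ∀ θ ∈ U, (covarianceFiber (G.pivotParams r P) θ).encard = h) ↔
      ∃ U ∈ basicOpens (polyAlgebra (piCoords fun _ => coord)) (G.componentParams r P),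
        ∀ η ∈ U, ∏ j, (covarianceFiber
          ((G.mixedComponent j).pivotParams (fun u => r u) P) (η j)).encard = h := by
  refine exists_mem_basicOpens_pivotParams_iff hr hP₀ hP₁ (fun U _ hU η hη => ?_)
    fun w _ U hUT hU θ hθ => ?_
  · rw [← encard_covarianceFiber_glue hr hP₀ hη.1, hU _ hη.2]
  · rw [← hU _ hθ.2, ← encard_covarianceFiber_glue hr hP₀ (hUT hθ.2),
      hθ.1.1.glue_restrictParams]

theorem exists_injOn_covarianceMap_iff (hr : G.IsTopologicalRank r) (hP₀ : 0 ∉ P) (hP₁ : 1 ∈ P) :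
    (∃ U ∈ basicOpens (polyAlgebra coord) (G.pivotParams r P), Set.InjOn covarianceMap U) ↔
      ∃ U ∈ basicOpens (polyAlgebra (piCoords fun _ => coord)) (G.componentParams r P),
        Set.InjOn (fun η j => covarianceMap (η j)) U := by
  refine exists_mem_basicOpens_pivotParams_iff hr hP₀ hP₁ (fun U _ hU η hη η' hη' h => ?_)
    fun w hw U _ hU θ hθ θ' hθ' h => ?_
  · have hcov j := congrFun h j
    exact eq_of_glue_eq hr hη.1 hη'.1
      (hU hη.2 hη'.2 (covarianceMap_glue_congr hr hη.1 hη'.1 hcov)) hcov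
  · rw [← hθ.1.1.glue_restrictParams w, ← hθ'.1.1.glue_restrictParams w]
    exact congrArg _ (hU hθ.2 hθ'.2 (funext
      (covarianceMap_restrictParams_congr hr hP₀ hθ.1 hθ'.1 hw h)))

theorem covarianceCoord_glue_mem_ratAlgebra (hr : G.IsTopologicalRank r)
    {U : Set (∀ j, ParamPair (G.componentVertices j) K)} (hU : U ⊆ G.componentParams r P)
    (e : V × V) :
    covarianceCoord e ∘ G.glue ∈ ratAlgebra (piCoords fun _ => covarianceCoord) U := by
  have hfac j := (entriesIn_iff_of_isLDL (hr.mixedComponent j).injective fun η hη =>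
    isLDL_ldlFactor_of_mem_pivotParams (hr.mixedComponent j) (hU hη j trivial)).1
      (entriesIn_covarianceMap_apply U j)
  exact (entriesIn_iff_of_isLDL hr.injective fun η hη => isLDL_covarianceMap_glue hr
    (fun j => (hU hη j trivial).1) fun j => isLDL_ldlFactor_of_mem_pivotParams
      (hr.mixedComponent j) (hU hη j trivial)).2
    ⟨entriesIn_glueCols fun j => (hfac j).1, glueVec_mem fun j => (hfac j).2⟩ e.1 e.2

theorem covarianceCoord_restrictParams_mem_ratAlgebra (hr : G.IsTopologicalRank r) (hP₀ : 0 ∉ P)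
    {U : Set (ParamPair V K)} (hU : U ⊆ G.pivotParams r P)
    {w : ∀ j, G.componentVertices j → K} (hw : ∀ j u, w j u ∈ P)
    (c : Σ j, G.componentVertices j × G.componentVertices j) :
    piCoords (fun _ => covarianceCoord) c ∘ (fun θ j => G.restrictParams j (w j) θ) ∈
      ratAlgebra covarianceCoord U := by
  have hfac := (entriesIn_iff_of_isLDL hr.injective
    fun θ hθ => isLDL_ldlFactor_of_mem_pivotParams hr (hU hθ)).1
      fun u v => coord_mem_ratAlgebra (s := covarianceCoord) (u, v)
  exact (entriesIn_iff_of_isLDL (hr.mixedComponent c.1).injective fun θ hθ =>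
    isLDL_covarianceMap_restrictParams hr (hU hθ).1
      (fun j u _ => ne_of_mem_of_not_mem (hw j u) hP₀)
      (isLDL_ldlFactor_of_mem_pivotParams hr (hU hθ)) c.1).2
    ⟨entriesIn_restrictCols hfac.1 fun _ => const_fun_mem _ 1,
      restrictVec_mem hfac.2 fun u => const_fun_mem _ (w c.1 u)⟩ c.2.1 c.2.2

theorem exists_coord_mem_ratAlgebra_iff (hr : G.IsTopologicalRank r) (hP₀ : 0 ∉ P) (hP₁ : 1 ∈ P) :
    (∃ U ∈ basicOpens (polyAlgebra coord) (G.pivotParams r P),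
      ∀ i, coord i ∈ ratAlgebra covarianceCoord U) ↔
      ∃ U ∈ basicOpens (polyAlgebra (piCoords fun _ => coord)) (G.componentParams r P),
        ∀ c, piCoords (fun _ => coord) c ∈ ratAlgebra (piCoords fun _ => covarianceCoord) U := by
  refine exists_mem_basicOpens_pivotParams_iff hr hP₀ hP₁ (fun U _ hU c => ?_)
    fun w hw U _ hU i => ?_
  · have hglue i := comp_mem_ratAlgebra (fun η hη => hη.2)
      (covarianceCoord_glue_mem_ratAlgebra hr (Set.sep_subset (G.componentParams r P)
        fun η => G.glue η ∈ U)) (hU i)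
    have hcov := entriesIn_covarianceMap_apply {η ∈ G.componentParams r P | G.glue η ∈ U} c.1
    have hrestrict := coord_restrictParams_comp_mem hglue (fun u => hcov u u) c.2
    refine mem_ratAlgebra_congr (fun η hη => ?_) hrestrict
    exact congrArg (coord c.2) (restrictParams_glue_of_mem hr hη.1 c.1)
  · have hrestrict c := comp_mem_ratAlgebra (fun θ hθ => hθ.2)
      (covarianceCoord_restrictParams_mem_ratAlgebra hr hP₀ (Set.sep_subset (G.pivotParams r P)
        fun θ => (fun j => G.restrictParams j (w j) θ) ∈ U) hw) (hU c)
    refine mem_ratAlgebra_congr (fun θ hθ => ?_) (coord_glue_comp_mem hrestrict i)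
    exact congrArg (coord i) (hθ.1.1.glue_restrictParams w)

end Transfer

end MixedGraph

namespace ParamPair

/-! ### Generic properties of the parametrization -/

section Generic

variable {V K : Type*} [CommRing K] {T : Set (ParamPair V K)}

theorem exists_isProperAlgebraicSubset_iff {Q : Set (ParamPair V K) → Prop} (hQ : Antitone Q) :
    (∃ W, IsProperAlgebraicSubset T W ∧ Q (T \ W)) ↔
      ∃ U ∈ basicOpens (polyAlgebra coord) T, Q U := by
  constructor
  · rintro ⟨W, ⟨⟨S, rfl⟩, hne⟩, hW⟩
    obtain ⟨θ, hθ, p, hp, hpθ⟩ : ∃ θ ∈ T, ∃ p ∈ S, MvPolynomial.eval θ.coords p ≠ 0 := by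
      by_contra! hzero
      exact hne (Set.Subset.antisymm (fun θ h => h.1) fun θ h => ⟨h, hzero θ h⟩)
    refine ⟨{θ' ∈ T | MvPolynomial.eval θ'.coords p ≠ 0},
      ⟨⟨θ, hθ, hpθ⟩, _, mem_polyAlgebra_iff.2 ⟨p, fun _ => rfl⟩, rfl⟩, hQ ?_ hW⟩
    exact fun θ' h => ⟨h.1, fun h' => h.2 (h'.2 p hp)⟩
  · rintro ⟨U, ⟨⟨θ, hθ⟩, f, hf, rfl⟩, hU⟩
    obtain ⟨p, hp⟩ := mem_polyAlgebra_iff.1 hf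
    refine ⟨{θ | θ ∈ T ∧ ∀ q ∈ ({p} : Set _), MvPolynomial.eval θ.coords q = 0},
      ⟨⟨{p}, rfl⟩, fun h => ?_⟩, hQ ?_ hU⟩
    · have hpθ := (h.symm ▸ hθ.1 :).2 p rfl
      exact hθ.2 ((hp θ).trans hpθ)
    · refine fun θ' h => ⟨h.1, fun h₀ => h.2 ⟨h.1, ?_⟩⟩
      rintro q rfl
      exact (hp θ').symm.trans h₀

variable [Fintype V] [DecidableEq V]

theorem isGenericallyToOne_iff {h : ℕ∞} :
    IsGenericallyToOne T h ↔ ∃ U ∈ basicOpens (polyAlgebra coord) T,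
      ∀ θ ∈ U, (covarianceFiber T θ).encard = h :=
  exists_isProperAlgebraicSubset_iff Set.antitone_bforall

theorem encard_covarianceFiber_ne_zero {θ : ParamPair V K} (hθ : θ ∈ T) :
    (covarianceFiber T θ).encard ≠ 0 :=
  Set.encard_ne_zero.2 ⟨θ, hθ, rfl⟩

end Generic

section Density

variable {V α K : Type*} [Fintype V] [DecidableEq V] [LinearOrder α] [Field K]

theorem exists_mem_minorProd_ne_zero [Infinite K] (r : V → α) {T U : Set (ParamPair V K)}
    (hT : ∀ θ ∈ T, ∀ t : K, (θ.1, (1 - t) • θ.2 + t • (1 : Matrix V V K)) ∈ T)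
    (hU : U ∈ basicOpens (polyAlgebra coord) T) : ∃ θ ∈ U, minorProd r θ.2 ≠ 0 := by
  obtain ⟨⟨θ, hθU⟩, f, hf, rfl⟩ := hU
  set γ : K → ParamPair V K := fun t => (θ.1, (1 - t) • θ.2 + t • (1 : Matrix V V K))
  have id_mem : (id : K → K) ∈ polyAlgebra fun _ : Unit => id := coord_mem_polyAlgebra _ ()
  have hfst : EntriesIn (polyAlgebra fun _ : Unit => id) fun t => (γ t).1 :=
    fun u v => const_fun_mem _ (θ.1 u v)
  have hsnd : EntriesIn (polyAlgebra fun _ : Unit => id) fun t => (γ t).2 := fun u v =>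
    add_mem (mul_mem (sub_mem (const_fun_mem _ 1) id_mem) (const_fun_mem _ (θ.2 u v)))
      (mul_mem id_mem (const_fun_mem _ ((1 : Matrix V V K) u v)))
  obtain ⟨t, hft, hmt⟩ := exists_ne_zero_and_ne_zero_of_mem_polyAlgebra_id
    (comp_mem_of_mem_polyAlgebra (forall_coord_comp_mem_iff.2 ⟨hfst, hsnd⟩) hf)
    (hsnd.minorProd (r := r)) ⟨0, by simpa [γ] using hθU.2⟩
    ⟨1, by simpa [γ] using minorProd_one_ne_zero⟩
  exact ⟨γ t, ⟨hT θ hθU.1 t, hft⟩, hmt⟩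

end Density

end ParamPair

namespace MixedGraph

open ParamPair

section Identifiability

variable {V : Type*} [Fintype V] [DecidableEq V] {G : MixedGraph V}

theorem genericallyIdentifiable_iff :
    G.GenericallyIdentifiable ↔ ∃ U ∈ basicOpens (polyAlgebra coord) G.realParams,
      Set.InjOn covarianceMap U :=
  exists_isProperAlgebraicSubset_iff fun _ _ hst ht => ht.mono hst

theorem genericallyInfiniteToOne_iff :
    G.GenericallyInfiniteToOne ↔ IsGenericallyToOne G.realParams ⊤ := by
  simp only [GenericallyInfiniteToOne, IsGenericallyToOne, Set.encard_eq_top_iff]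

theorem rationallyIdentifiable_iff :
    G.RationallyIdentifiable ↔ ∃ U ∈ basicOpens (polyAlgebra coord) G.realParams,
      ∀ i, coord i ∈ ratAlgebra covarianceCoord U := by
  refine (exists_isProperAlgebraicSubset_iff (T := G.realParams) (Q := fun U =>
    ∃ num den : (V × V) ⊕ (V × V) → MvPolynomial (V × V) ℝ, ∀ θ ∈ U, ∀ i,
      MvPolynomial.eval (fun e => covarianceMap θ e.1 e.2) (den i) ≠ 0 ∧
      MvPolynomial.eval (fun e => covarianceMap θ e.1 e.2) (num i) /
        MvPolynomial.eval (fun e => covarianceMap θ e.1 e.2) (den i) = θ.coords i)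
    fun s t hst ⟨num, den, h⟩ => ⟨num, den, fun θ hθ => h θ (hst hθ)⟩).trans ?_
  refine exists_congr fun U => and_congr_right fun _ => ⟨?_, fun h => ?_⟩
  · rintro ⟨num, den, h⟩ i
    exact ⟨_, mem_polyAlgebra_iff.2 ⟨num i, fun _ => rfl⟩, _,
      mem_polyAlgebra_iff.2 ⟨den i, fun _ => rfl⟩, fun θ hθ => h θ hθ i⟩
  · choose n hn d hd hnd using h
    choose num hnum using fun i => mem_polyAlgebra_iff.1 (hn i)
    choose den hden using fun i => mem_polyAlgebra_iff.1 (hd i)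
    refine ⟨num, den, fun θ hθ i => ?_⟩
    have h := hnd i θ hθ
    rwa [hnum, hden] at h

variable {α : Type*} [LinearOrder α] {r : V → α}

theorem realParams_eq_pivotParams (hr : G.IsTopologicalRank r) :
    G.realParams = G.pivotParams r (Set.Ioi 0) := by
  ext θ
  constructor
  · rintro ⟨⟨hfst, -⟩, hpos, hsnd⟩
    have hsupp : G.Supports θ := ⟨hfst, hsnd⟩
    exact ⟨hsupp, (exists_isLDL_covarianceMap_iff hr hsupp).2
      ((posDef_iff_exists_isLDL hr.injective).1 hpos)⟩
  · rintro ⟨hsupp, hLDL⟩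
    have hunit := (IsUnitUpper.one_sub (hsupp.fst_eq_zero_of_le hr)).isUnit_det hr.injective
    exact ⟨⟨hsupp.fst, (Matrix.isUnit_iff_isUnit_det _).2 hunit⟩,
      (posDef_iff_exists_isLDL hr.injective).2 ((exists_isLDL_covarianceMap_iff hr hsupp).1 hLDL),
      hsupp.snd⟩

theorem complexParams_sep_minorProd_ne_zero (hr : G.IsTopologicalRank r) :
    {θ ∈ G.complexParams | minorProd r θ.2 ≠ 0} = G.pivotParams r {0}ᶜ := by
  ext θ
  constructor
  · rintro ⟨⟨⟨hfst, -⟩, hsymm, hsnd⟩, hminor⟩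
    have hsupp : G.Supports θ := ⟨hfst, hsnd⟩
    have hLDL := isLDL_ldlFactor hr.injective hsymm hminor
    exact ⟨hsupp, (exists_isLDL_covarianceMap_iff hr hsupp).2 ⟨_, _, hLDL, hLDL.ne⟩⟩
  · rintro ⟨hsupp, hLDL⟩
    have hunit := (IsUnitUpper.one_sub (hsupp.fst_eq_zero_of_le hr)).isUnit_det hr.injective
    obtain ⟨R, d, h, -⟩ := (exists_isLDL_covarianceMap_iff hr hsupp).1 hLDL
    exact ⟨⟨⟨hsupp.fst, (Matrix.isUnit_iff_isUnit_det _).2 hunit⟩,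
      h.isSymm hr.injective, hsupp.snd⟩, h.minorProd_ne_zero hr.injective⟩

theorem covarianceFiber_complexParams (hr : G.IsTopologicalRank r) {θ : ParamPair V ℂ}
    (hθ : θ ∈ G.pivotParams r {0}ᶜ) :
    covarianceFiber G.complexParams θ = covarianceFiber (G.pivotParams r {0}ᶜ) θ := by
  ext θ'
  refine and_congr_left fun hcov => ⟨fun h => ⟨⟨h.1.1, h.2.2⟩, ?_⟩, fun h => ?_⟩
  · rw [hcov]
    exact hθ.2
  · rw [← complexParams_sep_minorProd_ne_zero hr] at h
    exact h.1

theorem exists_mem_complexParams_minorProd_ne_zero (r : V → α) {U : Set (ParamPair V ℂ)}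
    (hU : U ∈ basicOpens (polyAlgebra coord) G.complexParams) : ∃ θ ∈ U, minorProd r θ.2 ≠ 0 := by
  refine exists_mem_minorProd_ne_zero r (T := G.complexParams) (fun θ hθ t =>
    ⟨hθ.1, ?_, fun v w hvw hadj => ?_⟩) hU
  · exact (hθ.2.1.smul (1 - t)).add (Matrix.isSymm_one.smul t)
  · simp [hθ.2.2 v w hvw hadj, hvw]

theorem isGenericallyToOne_complexParams_iff (hr : G.IsTopologicalRank r) {h : ℕ∞} :
    IsGenericallyToOne G.complexParams h ↔
      IsGenericallyToOne (G.pivotParams (K := ℂ) r {0}ᶜ) h := by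
  have hminor : (fun θ : ParamPair V ℂ => minorProd r θ.2) ∈ polyAlgebra coord :=
    (forall_coord_comp_mem_iff.1 fun i => coord_mem_polyAlgebra coord i).2.minorProd
  rw [isGenericallyToOne_iff, isGenericallyToOne_iff, exists_mem_basicOpens_sep_iff hminor
    (fun U => exists_mem_complexParams_minorProd_ne_zero r)
    Set.antitone_bforall, complexParams_sep_minorProd_ne_zero hr]
  refine exists_congr fun U => and_congr_right fun hU => forall₂_congr fun θ hθ => ?_
  rw [covarianceFiber_complexParams hr (subset_of_mem_basicOpens hU hθ)]

end Identifiability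

section MixedComponents

variable {V α : Type*} [Fintype V] [DecidableEq V] [LinearOrder α] {G : MixedGraph V} {r : V → α}

section PivotParams

variable {K : Type*} [Field K] [NeZero (2 : K)] {P : Set K}

theorem isGenericallyToOne_pivotParams_iff (hr : G.IsTopologicalRank r) (hP₀ : 0 ∉ P)
    (hP₁ : 1 ∈ P) {h : ℕ∞} :
    IsGenericallyToOne (G.pivotParams r P) h ↔
      ∃ U ∈ basicOpens (polyAlgebra (piCoords fun _ => coord)) (G.componentParams r P),
        ∀ η ∈ U, ∏ j, (covarianceFiber
          ((G.mixedComponent j).pivotParams (fun u => r u) P) (η j)).encard = h :=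
  isGenericallyToOne_iff.trans (exists_encard_covarianceFiber_eq_iff hr hP₀ hP₁)

theorem isGenericallyToOne_top_pivotParams_iff (hr : G.IsTopologicalRank r) (hP₀ : 0 ∉ P)
    (hP₁ : 1 ∈ P) :
    IsGenericallyToOne (G.pivotParams r P) ⊤ ↔
      ∃ j, IsGenericallyToOne ((G.mixedComponent j).pivotParams (fun u => r u) P) ⊤ := by
  rw [isGenericallyToOne_pivotParams_iff hr hP₀ hP₁, exists_prod_eq_top_iff
    (componentParams_nonempty hP₁) fun _ _ => encard_covarianceFiber_ne_zero]
  simp only [isGenericallyToOne_iff]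

theorem isGenericallyToOne_prod_pivotParams (hr : G.IsTopologicalRank r) (hP₀ : 0 ∉ P)
    (hP₁ : 1 ∈ P) {h : G.ComponentIndex → ℕ∞}
    (hG : ∀ j, IsGenericallyToOne ((G.mixedComponent j).pivotParams (fun u => r u) P) (h j)) :
    IsGenericallyToOne (G.pivotParams r P) (∏ j, h j) :=
  (isGenericallyToOne_pivotParams_iff hr hP₀ hP₁).2
    (exists_prod_eq_of_forall fun j => isGenericallyToOne_iff.1 (hG j))

theorem sInf_isGenericallyToOne_pivotParams (hr : G.IsTopologicalRank r) (hP₀ : 0 ∉ P)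
    (hP₁ : 1 ∈ P) :
    sInf {h | IsGenericallyToOne (G.pivotParams r P) h} = ∏ j,
      sInf {h | IsGenericallyToOne ((G.mixedComponent j).pivotParams (fun u => r u) P) h} := by
  simp only [isGenericallyToOne_pivotParams_iff hr hP₀ hP₁]
  rw [sInf_prod_eq fun _ _ => encard_covarianceFiber_ne_zero]
  simp only [isGenericallyToOne_iff]

end PivotParams

theorem rationallyIdentifiable_iff_forall_mixedComponent (hr : G.IsTopologicalRank r) :
    G.RationallyIdentifiable ↔ ∀ j, (G.mixedComponent j).RationallyIdentifiable := by
  simp only [rationallyIdentifiable_iff, realParams_eq_pivotParams hr,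
    fun j => realParams_eq_pivotParams (hr.mixedComponent j)]
  rw [exists_coord_mem_ratAlgebra_iff hr Set.self_notMem_Ioi (Set.mem_Ioi.2 one_pos)]
  exact exists_coord_mem_ratAlgebra_pi_iff

theorem genericallyIdentifiable_iff_forall_mixedComponent (hr : G.IsTopologicalRank r) :
    G.GenericallyIdentifiable ↔ ∀ j, (G.mixedComponent j).GenericallyIdentifiable := by
  simp only [genericallyIdentifiable_iff, realParams_eq_pivotParams hr,
    fun j => realParams_eq_pivotParams (hr.mixedComponent j)]
  rw [exists_injOn_covarianceMap_iff hr Set.self_notMem_Ioi (Set.mem_Ioi.2 one_pos)]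
  exact exists_injOn_pi_iff

theorem genericallyInfiniteToOne_iff_exists_mixedComponent (hr : G.IsTopologicalRank r) :
    G.GenericallyInfiniteToOne ↔ ∃ j, (G.mixedComponent j).GenericallyInfiniteToOne := by
  simp only [genericallyInfiniteToOne_iff, realParams_eq_pivotParams hr,
    fun j => realParams_eq_pivotParams (hr.mixedComponent j)]
  exact isGenericallyToOne_top_pivotParams_iff hr Set.self_notMem_Ioi (Set.mem_Ioi.2 one_pos)

theorem isGenericallyToOne_prod_realParams (hr : G.IsTopologicalRank r)
    {h : G.ComponentIndex → ℕ∞}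
    (hG : ∀ j, IsGenericallyToOne (G.mixedComponent j).realParams (h j)) :
    IsGenericallyToOne G.realParams (∏ j, h j) := by
  rw [realParams_eq_pivotParams hr]
  refine isGenericallyToOne_prod_pivotParams hr Set.self_notMem_Ioi (Set.mem_Ioi.2 one_pos)
    fun j => ?_
  rw [← realParams_eq_pivotParams (hr.mixedComponent j)]
  exact hG j

theorem isGenericallyToOne_top_complexParams_iff (hr : G.IsTopologicalRank r) :
    IsGenericallyToOne G.complexParams ⊤ ↔
      ∃ j, IsGenericallyToOne (G.mixedComponent j).complexParams ⊤ := by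
  simp only [isGenericallyToOne_complexParams_iff hr,
    fun j => isGenericallyToOne_complexParams_iff (hr.mixedComponent j) (h := ⊤)]
  exact isGenericallyToOne_top_pivotParams_iff hr (by simp) (by simp)

theorem isGenericallyToOne_prod_complexParams (hr : G.IsTopologicalRank r)
    {h : G.ComponentIndex → ℕ∞}
    (hG : ∀ j, IsGenericallyToOne (G.mixedComponent j).complexParams (h j)) :
    IsGenericallyToOne G.complexParams (∏ j, h j) :=
  (isGenericallyToOne_complexParams_iff hr).2 <| isGenericallyToOne_prod_pivotParams hr (by simp)
    (by simp) fun j => (isGenericallyToOne_complexParams_iff (hr.mixedComponent j)).1 (hG j)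

theorem identifiabilityDegree_eq_prod (hr : G.IsTopologicalRank r) :
    G.identifiabilityDegree = ∏ j, (G.mixedComponent j).identifiabilityDegree := by
  simp only [identifiabilityDegree, isGenericallyToOne_complexParams_iff hr,
    fun j h => isGenericallyToOne_complexParams_iff (hr.mixedComponent j) (h := h)]
  exact sInf_isGenericallyToOne_pivotParams hr (by simp) (by simp)

end MixedComponents

end MixedGraph

theorem theorem9 {V : Type*} [Fintype V] [DecidableEq V] (G : MixedGraph V) (hG : G.Acyclic) :
    -- (i) rational identifiability and generic identifiability
    (G.RationallyIdentifiable ↔ ∀ j, (G.mixedComponent j).RationallyIdentifiable) ∧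
    (G.GenericallyIdentifiable ↔ ∀ j, (G.mixedComponent j).GenericallyIdentifiable) ∧
    -- (ii) for the real map and for its complex extension
    (G.GenericallyInfiniteToOne ↔ ∃ j, (G.mixedComponent j).GenericallyInfiniteToOne) ∧
    (IsGenericallyToOne G.complexParams ⊤ ↔
      ∃ j, IsGenericallyToOne (G.mixedComponent j).complexParams ⊤) ∧
    -- (iii) for the real map and for its complex extension
    (∀ h : G.ComponentIndex → ℕ,
      (∀ j, IsGenericallyToOne (G.mixedComponent j).realParams (h j : ℕ∞)) →
        IsGenericallyToOne G.realParams ((∏ j, h j : ℕ) : ℕ∞)) ∧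
    (∀ h : G.ComponentIndex → ℕ,
      (∀ j, IsGenericallyToOne (G.mixedComponent j).complexParams (h j : ℕ∞)) →
        IsGenericallyToOne G.complexParams ((∏ j, h j : ℕ) : ℕ∞)) ∧
    G.identifiabilityDegree = ∏ j, (G.mixedComponent j).identifiabilityDegree := by
  obtain ⟨α, _, r, hr⟩ := hG.exists_isTopologicalRank
  refine ⟨MixedGraph.rationallyIdentifiable_iff_forall_mixedComponent hr,
    MixedGraph.genericallyIdentifiable_iff_forall_mixedComponent hr,
    MixedGraph.genericallyInfiniteToOne_iff_exists_mixedComponent hr,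
    MixedGraph.isGenericallyToOne_top_complexParams_iff hr, fun h hreal => ?_, fun h hcomplex => ?_,
    MixedGraph.identifiabilityDegree_eq_prod hr⟩
  · rw [Nat.cast_prod]
    exact MixedGraph.isGenericallyToOne_prod_realParams hr hreal
  · rw [Nat.cast_prod]
    exact MixedGraph.isGenericallyToOne_prod_complexParams hr hcomplex
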